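/- Let $n\ge 1$, let $\varphi\ge 0$ be a measurable probability density on $\mathbb R$ with distribution function $F$ and inverse $F^{-1}$ on $(0,1)$, let $\mu_r=\varphi(x)\,dx$ and let $\mu=\mu_r^{\otimes n}$ be the product probability measure on $\Omega=\mathbb R^n$ with the Euclidean distance $d$. Let $I:[0,1]\to[0,\infty)$ be the isoperimetric profile of $(\Omega,d,\mu)$, i.e. the largest function with $Per(A)\ge I(\mu(A))$ for all Borel $A$, where $Per(A)=\liminf_{\varepsilon\to0^+}\varepsilon^{-1}(\mu(A_\varepsilon)-\mu(A))$ and $A_\varepsilon$ is the open $\varepsilon$-neighbourhood of $A$. Assume that $I$ is concave, continuous, increasing on $(0,1/2)$ and symmetric about $1/2$, and that $I(t)\approx\varphi(F^{-1}(t))$ on $(0,1)$. For a measurable function $f$ on a probability space write $f^*$ for its decreasing rearrangement (that of $|f|$) and $f^{**}(t)=\frac1t\int_0^tf^*(s)\,ds$; for Lipschitz $f$ on $\Omega$ put $|\nabla f|(x)=\limsup_{y\to x}|f(x)-f(y)|/d(x,y)$. Let $X,Y$ be rearrangement invariant Banach function spaces on $(\Omega,\mu)$ (in the sense of Bennett–Sharpley),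 and $\bar X,\bar Y$ their representations on $(0,1)$ with Lebesgue measure: $\|g\|_{\bar X}=\|f\|_X$ whenever $f^*=g^*$. Inequalities $\preceq$ hold up to a constant independent of $f$. Then the following are equivalent: (i) $\|f-\int f\,d\mu\|_Y\preceq\||\nabla f|\|_X$ for all Lipschitz $f:\Omega\to\mathbb R$; (ii) $\left\|\int_t^1f(s)\frac{ds}{I(s)}\right\|_{\bar Y}\preceq\|f\|_{\bar X}$ for all $0\le f\in\bar X$ supported in $(0,1/2)$. Moreover: (a) If $Q_If(t)=\frac{I(t)}t\int_t^1f(s)\frac{ds}{I(s)}$ satisfies $\|Q_If\|_{\bar X}\preceq\|f\|_{\bar X}$ for all $0\le f\in\bar X$ supported in $(0,1/2)$, then (i) and (ii) are also equivalent to (iii) $\|f\|_{\bar Y}\preceq\left\|f^*(t)\frac{I(t)}t\right\|_{\bar X}$ for all measurable $f$ on $(0,1)$. (b) If $\|f\|_X\simeq\|f^{**}\|_{\bar X}$ for all measurable $f$ on $\Omega$ (whether or not $Q_I$ is bounded on $\bar X$), then (i) and (ii) are also equivalent to (iv) $\|f\|_{\bar Y}\preceq\|f\|_{LS(X)}+\|f\|_{L^1}$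 for all measurable $f$ on $(0,1)$, where $\|f\|_{LS(X)}=\left\|(f^{**}(t)-f^*(t))\frac{I(t)}t\right\|_{\bar X}$. -/

import Mathlib

open MeasureTheory Set Filter Topology
open scoped ENNReal NNReal

namespace IsoSym

noncomputable section

/-- The decreasing rearrangement of a `[0,∞]`-valued function,
`f*(s) = inf {t ≥ 0 : μ {f > t} ≤ s}`. -/
def rearr {Ω : Type*} [MeasurableSpace Ω] (μ : Measure Ω) (f : Ω → ℝ≥0∞) (s : ℝ) : ℝ≥0∞ :=
  sInf {t : ℝ≥0∞ | μ {x | t < f x} ≤ ENNReal.ofReal s}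

/-- The maximal rearrangement `f**(t) = (1/t) ∫₀ᵗ f*(s) ds`. -/
def maxRearr {Ω : Type*} [MeasurableSpace Ω] (μ : Measure Ω) (f : Ω → ℝ≥0∞) (t : ℝ) : ℝ≥0∞ :=
  (∫⁻ s in Ioo 0 t, rearr μ f s) / ENNReal.ofReal t

/-- Lebesgue measure on `(0,1)`. -/
def unitMeasure : Measure ℝ := volume.restrict (Ioo 0 1)

/-- A rearrangement invariant Banach function norm (in the sense of Bennett and Sharpley)
on the cone of measurable functions with values in `[0,∞]`. The r.i. space is
the set of measurable `f` for which the norm of `|f|` is finite. -/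
structure RINorm {Ω : Type*} [MeasurableSpace Ω] (μ : Measure Ω) where
  /-- the norm of a nonnegative function -/
  norm : (Ω → ℝ≥0∞) → ℝ≥0∞
  norm_eq_zero_iff : ∀ f, Measurable f → (norm f = 0 ↔ f =ᵐ[μ] 0)
  norm_smul : ∀ (a : ℝ≥0) (f), Measurable f → norm (fun x => a * f x) = a * norm f
  norm_add_le : ∀ f g, Measurable f → Measurable g →
    norm (fun x => f x + g x) ≤ norm f + norm g
  norm_mono : ∀ f g, Measurable f → Measurable g → f ≤ᵐ[μ] g → norm f ≤ norm g
  norm_iSup : ∀ f : ℕ → Ω → ℝ≥0∞, (∀ k, Measurable (f k)) → Monotone f →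
    norm (fun x => ⨆ k, f k x) = ⨆ k, norm (f k)
  norm_indicator_lt_top : ∀ E, MeasurableSet E → μ E < ∞ →
    norm (E.indicator fun _ => 1) < ∞
  lintegral_le : ∀ E, MeasurableSet E → μ E < ∞ →
    ∃ C : ℝ≥0, ∀ f, Measurable f → ∫⁻ x in E, f x ∂μ ≤ C * norm f
  norm_rearr : ∀ f g, Measurable f → Measurable g →
    (∀ s : ℝ, 0 < s → rearr μ f s = rearr μ g s) → norm f = norm g

/-- The norm of the representation space `X̄(0,1)`: the norm of `g` on `(0,1)` is the norm in `X`
of any function on `Ω` with the same decreasing rearrangement as `g`. (All such functions have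
the same norm, so the supremum only selects this common value.) -/
def RINorm.bar {Ω : Type*} [MeasurableSpace Ω] {μ : Measure Ω} (X : RINorm μ)
    (g : ℝ → ℝ≥0∞) : ℝ≥0∞ :=
  ⨆ (f : Ω → ℝ≥0∞) (_ : Measurable f)
    (_ : ∀ s : ℝ, 0 < s → rearr μ f s = rearr unitMeasure g s), X.norm f

/-- The perimeter (lower Minkowski content)
`Per(A) = liminf_{ε → 0+} (μ(A_ε) - μ(A)) / ε`. -/
def perimeter {Ω : Type*} [PseudoMetricSpace Ω] [MeasurableSpace Ω] (μ : Measure Ω)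
    (A : Set Ω) : ℝ≥0∞ :=
  liminf (fun ε : ℝ => (μ (Metric.thickening ε A) - μ A) / ENNReal.ofReal ε) (𝓝[>] 0)

/-- The isoperimetric profile: the largest function `I` with `Per(A) ≥ I(μ(A))` for all Borel
sets `A`. -/
def isoProfile {Ω : Type*} [PseudoMetricSpace Ω] [MeasurableSpace Ω] (μ : Measure Ω)
    (t : ℝ) : ℝ≥0∞ :=
  ⨅ (A : Set Ω) (_ : MeasurableSet A) (_ : μ A = ENNReal.ofReal t), perimeter μ A

/-- The modulus of the gradient `|∇f|(x) = limsup_{y → x} |f(x) - f(y)| / d(x,y)`. -/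
def gradMod {Ω : Type*} [PseudoMetricSpace Ω] (f : Ω → ℝ) (x : Ω) : ℝ≥0∞ :=
  limsup (fun y => ENNReal.ofReal (|f x - f y| / dist x y)) (𝓝[≠] x)

/-- The shape assumptions on a profile `I : [0,1] → [0,∞)`: concave, continuous,
increasing on `(0,1/2)`, symmetric about `1/2`. -/
structure RegularProfile (I : ℝ → ℝ≥0∞) : Prop where
  ne_top : ∀ t ∈ Icc (0 : ℝ) 1, I t ≠ ∞
  concave : ConcaveOn ℝ (Icc 0 1) fun t => (I t).toReal
  continuous : ContinuousOn I (Icc 0 1)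
  monotone : MonotoneOn I (Ioo 0 (1 / 2))
  symmetric : ∀ t ∈ Icc (0 : ℝ) 1, I (1 - t) = I t

/-- The probability measure `φ(x) dx` on the line. -/
def lineMeasure (φ : ℝ → ℝ) : Measure ℝ :=
  volume.withDensity fun x => ENNReal.ofReal (φ x)

/-- The `n`-fold product measure on Euclidean space `ℝⁿ`. -/
def prodMeasure (n : ℕ) (φ : ℝ → ℝ) : Measure (EuclideanSpace ℝ (Fin n)) :=
  (Measure.pi fun _ : Fin n => lineMeasure φ).map (WithLp.toLp 2)

/-- The inverse `F⁻¹` on `(0,1)` of the distribution function of `φ(x) dx`. -/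
def invCdf (φ : ℝ → ℝ) (t : ℝ) : ℝ :=
  sInf {x : ℝ | t ≤ ProbabilityTheory.cdf (lineMeasure φ) x}

/-- `I(t) ≈ J(t)` on `(0,1)`. -/
def Comparable (I J : ℝ → ℝ≥0∞) : Prop :=
  ∃ c C : ℝ≥0, 0 < c ∧ ∀ t ∈ Ioo (0 : ℝ) 1, c * J t ≤ I t ∧ I t ≤ C * J t

/-- The weighted Hardy operator `f ↦ ∫ₜ¹ f(s) ds / I(s)`. -/
def hardyOp (I : ℝ → ℝ≥0∞) (f : ℝ → ℝ≥0∞) (t : ℝ) : ℝ≥0∞ :=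
  ∫⁻ s in Ioo t 1, f s / I s

/-- The operator `Q_I f(t) = (I(t)/t) ∫ₜ¹ f(s) ds / I(s)`. -/
def opQ (I : ℝ → ℝ≥0∞) (f : ℝ → ℝ≥0∞) (t : ℝ) : ℝ≥0∞ :=
  I t / ENNReal.ofReal t * hardyOp I f t

/-- The Poincaré inequality `‖f - ∫ f‖_Y ≲ ‖∇f‖_X` for all Lipschitz `f`. -/
def Poincare {Ω : Type*} [PseudoMetricSpace Ω] [MeasurableSpace Ω] {μ : Measure Ω}
    (X Y : RINorm μ) : Prop :=
  ∃ C : ℝ≥0, ∀ f : Ω → ℝ, (∃ K : ℝ≥0, LipschitzWith K f) →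
    Y.norm (fun x => ‖f x - ∫ y, f y ∂μ‖ₑ) ≤ C * X.norm (gradMod f)

/-- `‖∫ₜ¹ f(s) ds / I(s)‖_Ȳ ≲ ‖f‖_X̄` for all `0 ≤ f ∈ X̄` supported in `(0,1/2)`. -/
def HardyBounded {Ω : Type*} [MeasurableSpace Ω] {μ : Measure Ω}
    (I : ℝ → ℝ≥0∞) (X Y : RINorm μ) : Prop :=
  ∃ C : ℝ≥0, ∀ f : ℝ → ℝ≥0∞, Measurable f → X.bar f < ∞ →
    Function.support f ⊆ Ioo 0 (1 / 2) → Y.bar (hardyOp I f) ≤ C * X.bar f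

/-- `‖Q_I f‖_X̄ ≲ ‖f‖_X̄` for all `0 ≤ f ∈ X̄` supported in `(0,1/2)`. -/
def QBounded {Ω : Type*} [MeasurableSpace Ω] {μ : Measure Ω}
    (I : ℝ → ℝ≥0∞) (X : RINorm μ) : Prop :=
  ∃ C : ℝ≥0, ∀ f : ℝ → ℝ≥0∞, Measurable f → X.bar f < ∞ →
    Function.support f ⊆ Ioo 0 (1 / 2) → X.bar (opQ I f) ≤ C * X.bar f

/-- `‖f‖_Ȳ ≲ ‖f*(t) I(t)/t‖_X̄` for all measurable `f` on `(0,1)`. -/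
def WeightedEmbedding {Ω : Type*} [MeasurableSpace Ω] {μ : Measure Ω}
    (I : ℝ → ℝ≥0∞) (X Y : RINorm μ) : Prop :=
  ∃ C : ℝ≥0, ∀ f : ℝ → ℝ≥0∞, Measurable f →
    Y.bar f ≤ C * X.bar fun t => rearr unitMeasure f t * (I t / ENNReal.ofReal t)

/-- `‖f‖_X ≃ ‖f**‖_X̄`. -/
def MaximalNormEquiv {Ω : Type*} [MeasurableSpace Ω] {μ : Measure Ω}
    (X : RINorm μ) : Prop :=
  ∃ C : ℝ≥0, ∀ f : Ω → ℝ≥0∞, Measurable f →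
    X.norm f ≤ C * X.bar (maxRearr μ f) ∧ X.bar (maxRearr μ f) ≤ C * X.norm f

/-- `‖f‖_{LS(X)} = ‖(f**(t) - f*(t)) I(t)/t‖_X̄` for `f` on `(0,1)`. -/
def normLS {Ω : Type*} [MeasurableSpace Ω] {μ : Measure Ω}
    (I : ℝ → ℝ≥0∞) (X : RINorm μ) (f : ℝ → ℝ≥0∞) : ℝ≥0∞ :=
  X.bar fun t =>
    (maxRearr unitMeasure f t - rearr unitMeasure f t) * (I t / ENNReal.ofReal t)

/-- `‖f‖_Ȳ ≲ ‖f‖_{LS(X)} + ‖f‖_{L¹}` for all measurable `f` on `(0,1)`. -/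
def LSEmbedding {Ω : Type*} [MeasurableSpace Ω] {μ : Measure Ω}
    (I : ℝ → ℝ≥0∞) (X Y : RINorm μ) : Prop :=
  ∃ C : ℝ≥0, ∀ f : ℝ → ℝ≥0∞, Measurable f →
    Y.bar f ≤ C * (normLS I X f + ∫⁻ t, f t ∂unitMeasure)

end

end IsoSym

/-! The distribution function `F` of the line measure has no jumps, so `U x = F (x i)` carries the
product measure to Lebesgue measure on `(0,1)`. Hence the norm of `g` in the representation space is
the norm of `g ∘ U` (`RINorm.bar_eq`), and a comparison of distributions gives a comparison of
norms.

Hardy implies Poincaré: let `p` be positive on at most half of the space and `s_j = 2^{-j-1}`, `a_j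
= p*(s_j)`. For levels strictly between `a_j` and `a_{j+1}` the superlevel sets of `p` have measure
between `s_{j+1}` and `s_j`, hence perimeter at least `I(s_{j+1})`. A coarea inequality bounds
`(a_{j+1} - a_j) I(s_{j+1})` by the integral of the gradient over `{a_j < p < a_{j+1}}`. These sets
are disjoint, and the j-th fits into `(s_{j+1}, s_j)`, so rearranging the gradient on each
separately yields `h` on `(0,1/2)`, with distribution dominated by that of the gradient, and `p*(t)
≤ 2 ∫_{t/2}^1 h/I` (`exists_rearr_le_hardyOp`). Dilation by 2 is bounded on r.i. spaces. The result
is applied to the two sides of a median, which is then exchanged for the mean.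

Poincaré implies Hardy: for bounded `f` the function `x ↦ ∫_{F(x i)}^1 f/I` is Lipschitz, and its
slope `φ f(F)/I(F)` is at most a multiple of `f(F)`, because `I` dominates `φ ∘ F⁻¹`
(`exists_lipschitz_hardyOp`). It vanishes on half of the space, so subtracting the mean is harmless.
Truncation removes boundedness.

The embeddings follow from Hardy by writing `f*` as a Hardy transform: of `f* I/t` by monotonicity
of `f*`, or of `(f** - f*) I/t` up to an `L¹` term. Conversely both embeddings are tested on Hardy
transforms. For (iii) the right side becomes `Q_I f`; for (iv), since `I(t)/t` decreases, it is at
most `f**` plus an `L¹` norm. -/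

namespace IsoSym

/-! ### Decreasing rearrangements and equimeasurability -/

section Rearrangement

variable {Ω : Type*} [MeasurableSpace Ω] {μ : Measure Ω}

lemma rearr_antitone (μ : Measure Ω) (f : Ω → ℝ≥0∞) : Antitone (rearr μ f) := by
  intro s t hst
  exact sInf_le_sInf fun τ hτ => le_trans (α := ℝ≥0∞) hτ (ENNReal.ofReal_le_ofReal hst)

lemma measurable_rearr (μ : Measure Ω) (f : Ω → ℝ≥0∞) : Measurable (rearr μ f) :=
  (rearr_antitone μ f).measurable

/-- The distribution function is right-continuous, by continuity of measure along levels decreasing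
to `τ`, so the infimum defining the rearrangement is attained. Strict inequalities therefore pass
through exactly. -/
lemma lt_rearr_iff {f : Ω → ℝ≥0∞} {s : ℝ} {τ : ℝ≥0∞} :
    τ < rearr μ f s ↔ ENNReal.ofReal s < μ {x | τ < f x} := by
  constructor
  · intro h
    by_contra! hc
    exact absurd (sInf_le hc : rearr μ f s ≤ τ) (not_le.2 h)
  · intro h
    by_contra! hc
    refine absurd h (not_lt.2 ?_)
    rcases eq_or_ne τ ⊤ with rfl | hτ
    · simp
    obtain ⟨u, hu, hu', hlim⟩ := exists_seq_strictAnti_tendsto' (lt_top_iff_ne_top.2 hτ)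
    have hun : {x | τ < f x} = ⋃ n, {x | u n < f x} := by
      ext x
      simp only [mem_ofPred_eq, mem_iUnion]
      constructor
      · intro hx
        exact ((tendsto_order.1 hlim).2 _ hx).exists
      · rintro ⟨n, hn⟩
        exact (hu' n).1.trans hn
    rw [hun, Monotone.measure_iUnion]
    · refine iSup_le fun n => ?_
      obtain ⟨t, ht, htn⟩ := sInf_lt_iff.1 (lt_of_le_of_lt hc (hu' n).1)
      exact (measure_mono fun x hx => htn.trans hx).trans ht
    · intro m n hmn x hx
      exact (hu.antitone hmn).trans_lt hx

lemma rearr_le_iff {f : Ω → ℝ≥0∞} {s : ℝ} {τ : ℝ≥0∞} :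
    rearr μ f s ≤ τ ↔ μ {x | τ < f x} ≤ ENNReal.ofReal s := by
  rw [← not_lt, lt_rearr_iff, not_lt]

lemma rearr_congr {Ω' : Type*} [MeasurableSpace Ω'] {ν : Measure Ω'} {f : Ω → ℝ≥0∞}
    {g : Ω' → ℝ≥0∞} (h : ∀ τ, μ {x | τ < f x} = ν {x | τ < g x}) : rearr μ f = rearr ν g := by
  funext s
  simp only [rearr, h]

lemma rearr_mono_of_dist {Ω' : Type*} [MeasurableSpace Ω'] {ν : Measure Ω'} {f : Ω → ℝ≥0∞}
    {g : Ω' → ℝ≥0∞} (h : ∀ τ, μ {x | τ < f x} ≤ ν {x | τ < g x}) (s : ℝ) :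
    rearr μ f s ≤ rearr ν g s :=
  sInf_le_sInf fun τ hτ => (h τ).trans hτ

instance : IsProbabilityMeasure unitMeasure := ⟨by simp [unitMeasure]⟩

lemma unitMeasure_apply (s : Set ℝ) : unitMeasure s = volume (s ∩ Ioo 0 1) :=
  Measure.restrict_apply' measurableSet_Ioo

lemma ae_unitMeasure_iff {p : ℝ → Prop} :
    (∀ᵐ t ∂unitMeasure, p t) ↔ ∀ᵐ t, t ∈ Ioo (0 : ℝ) 1 → p t :=
  ae_restrict_iff' measurableSet_Ioo

lemma ae_unitMeasure_of_forall {p : ℝ → Prop} (h : ∀ t ∈ Ioo (0 : ℝ) 1, p t) :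
    ∀ᵐ t ∂unitMeasure, p t :=
  ae_unitMeasure_iff.2 (ae_of_all _ h)

/-- Equimeasurability of `f` and `f*`: within `(0,1)` the superlevel set of `f*` is the interval
`(0, μ{f > τ})`. -/
lemma unitMeasure_lt_rearr [IsProbabilityMeasure μ] (f : Ω → ℝ≥0∞) (τ : ℝ≥0∞) :
    unitMeasure {s | τ < rearr μ f s} = μ {x | τ < f x} := by
  have hm : μ {x | τ < f x} ≠ ⊤ := measure_ne_top _ _
  have : {s | τ < rearr μ f s} ∩ Ioo 0 1 = Ioo 0 (μ {x | τ < f x}).toReal := by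
    ext s
    simp only [mem_inter_iff, mem_ofPred_eq, lt_rearr_iff, mem_Ioo]
    have h1 : (μ {x | τ < f x}).toReal ≤ 1 := by
      simpa using ENNReal.toReal_mono ENNReal.one_ne_top (prob_le_one (μ := μ) (s := {x | τ < f x}))
    constructor
    · rintro ⟨h, h0, -⟩
      exact ⟨h0, (ENNReal.ofReal_lt_iff_lt_toReal h0.le hm).1 h⟩
    · rintro ⟨h0, h⟩
      exact ⟨(ENNReal.ofReal_lt_iff_lt_toReal h0.le hm).2 h, h0, h.trans_le h1⟩
  rw [unitMeasure_apply, this, Real.volume_Ioo, sub_zero, ENNReal.ofReal_toReal hm]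

lemma rearr_rearr [IsProbabilityMeasure μ] (f : Ω → ℝ≥0∞) :
    rearr unitMeasure (rearr μ f) = rearr μ f :=
  rearr_congr (unitMeasure_lt_rearr f)

lemma lintegral_eq_of_dist {Ω' : Type*} [MeasurableSpace Ω'] {ν : Measure Ω'}
    [IsProbabilityMeasure μ] [IsProbabilityMeasure ν] {f : Ω → ℝ≥0∞} {g : Ω' → ℝ≥0∞}
    (hf : Measurable f) (hg : Measurable g) (h : ∀ τ, μ {x | τ < f x} = ν {x | τ < g x}) :
    ∫⁻ x, f x ∂μ = ∫⁻ x, g x ∂ν := by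
  have := Measure.isProbabilityMeasure_map (μ := μ) hf.aemeasurable
  have := Measure.isProbabilityMeasure_map (μ := ν) hg.aemeasurable
  have hmap : μ.map f = ν.map g := by
    refine Measure.ext_of_Iic _ _ fun τ => ?_
    rw [← compl_Ioi, prob_compl_eq_one_sub measurableSet_Ioi,
      prob_compl_eq_one_sub measurableSet_Ioi, Measure.map_apply hf measurableSet_Ioi,
      Measure.map_apply hg measurableSet_Ioi]
    congr 1
    exact h τ
  have e1 := lintegral_map (μ := μ) measurable_id hf
  have e2 := lintegral_map (μ := ν) measurable_id hg
  simp only [id] at e1 e2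
  rw [← e1, ← e2, hmap]

lemma lintegral_rearr [IsProbabilityMeasure μ] {f : Ω → ℝ≥0∞} (hf : Measurable f) :
    ∫⁻ t, rearr μ f t ∂unitMeasure = ∫⁻ x, f x ∂μ :=
  lintegral_eq_of_dist (measurable_rearr _ _) hf (unitMeasure_lt_rearr f)

/-- The rearrangement of a function that vanishes off `E` vanishes past `μ E`, so its integral is
already attained on `(0, a)` for `μ E ≤ a`. -/
lemma lintegral_rearr_Ioo [IsProbabilityMeasure μ] {f : Ω → ℝ≥0∞} (hf : Measurable f) {E : Set Ω}
    (hE : ∀ x, x ∉ E → f x = 0) {a : ℝ} (ha1 : a ≤ 1) (hEa : μ E ≤ ENNReal.ofReal a) :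
    ∫⁻ t in Ioo 0 a, rearr μ f t = ∫⁻ x, f x ∂μ := by
  rw [← lintegral_rearr hf, unitMeasure]
  have hsub : Ioo (0 : ℝ) a ⊆ Ioo 0 1 := Ioo_subset_Ioo_right ha1
  rw [← lintegral_indicator measurableSet_Ioo, ← lintegral_indicator measurableSet_Ioo]
  refine lintegral_congr_ae ?_
  filter_upwards with t
  by_cases ht : t ∈ Ioo (0 : ℝ) a
  · rw [indicator_of_mem ht, indicator_of_mem (hsub ht)]
  · rw [indicator_of_notMem ht]
    by_cases ht1 : t ∈ Ioo (0 : ℝ) 1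
    · rw [indicator_of_mem ht1, eq_comm, ← nonpos_iff_eq_zero, rearr_le_iff]
      have hat : a ≤ t := by
        by_contra! hlt
        exact ht ⟨ht1.1, hlt⟩
      refine ((measure_mono ?_).trans hEa).trans (ENNReal.ofReal_le_ofReal hat)
      intro x hx
      by_contra hxE
      simp [hE x hxE] at hx
    · rw [indicator_of_notMem ht1]

/-- A case of the Hardy–Littlewood inequality. -/
lemma lintegral_Ioo_le_lintegral_rearr {g : ℝ → ℝ≥0∞} (hg : Measurable g) {a : ℝ} (ha1 : a ≤ 1) :
    ∫⁻ t in Ioo 0 a, g t ≤ ∫⁻ t in Ioo 0 a, rearr unitMeasure g t := by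
  have hsub : Ioo (0 : ℝ) a ⊆ Ioo 0 1 := Ioo_subset_Ioo_right ha1
  set g' := (Ioo 0 a).indicator g with hg'
  have h1 : ∫⁻ t in Ioo 0 a, g t = ∫⁻ t, g' t ∂unitMeasure := by
    rw [hg', lintegral_indicator measurableSet_Ioo, unitMeasure,
      Measure.restrict_restrict measurableSet_Ioo, inter_eq_left.2 hsub]
  have h2 : unitMeasure (Ioo 0 a) ≤ ENNReal.ofReal a := by
    rw [unitMeasure_apply, inter_eq_left.2 hsub, Real.volume_Ioo, sub_zero]
  rw [h1, ← lintegral_rearr_Ioo (hg.indicator measurableSet_Ioo) (E := Ioo 0 a)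
    (fun x hx => indicator_of_notMem hx _) ha1 h2]
  refine lintegral_mono fun t => rearr_mono_of_dist (fun τ => measure_mono fun x hx => ?_) t
  exact lt_of_lt_of_le (show τ < (Ioo 0 a).indicator g x from hx) (indicator_le_self _ _ _)

lemma measurable_maxRearr (μ : Measure Ω) (f : Ω → ℝ≥0∞) : Measurable (maxRearr μ f) := by
  refine Measurable.div (Monotone.measurable fun s t hst => ?_) ENNReal.measurable_ofReal
  exact lintegral_mono_set (Ioo_subset_Ioo_right hst)

end Rearrangement

/-! ### Transfer of r.i. norms to the unit interval -/

section Norm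

variable {Ω : Type*} [MeasurableSpace Ω] {μ : Measure Ω} {U : Ω → ℝ}

lemma measure_lt_comp (hU : MeasurePreserving U μ unitMeasure) {g : ℝ → ℝ≥0∞}
    (hg : Measurable g) (τ : ℝ≥0∞) : μ {x | τ < g (U x)} = unitMeasure {t | τ < g t} :=
  hU.measure_preimage (measurableSet_lt measurable_const hg).nullMeasurableSet

lemma rearr_comp (hU : MeasurePreserving U μ unitMeasure) {g : ℝ → ℝ≥0∞} (hg : Measurable g) :
    rearr μ (g ∘ U) = rearr unitMeasure g :=
  rearr_congr fun τ => measure_lt_comp hU hg τ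

/-- The composition `g ∘ U` is a competitor in the supremum, and rearrangement invariance gives
every other competitor the same norm. All properties of the representation norm are read off from
this formula. -/
lemma RINorm.bar_eq (X : RINorm μ) (hU : MeasurePreserving U μ unitMeasure) {g : ℝ → ℝ≥0∞}
    (hg : Measurable g) : X.bar g = X.norm (g ∘ U) := by
  refine le_antisymm (iSup_le fun f => iSup_le fun hf => iSup_le fun h => ?_) ?_
  · refine (X.norm_rearr _ _ hf (hg.comp hU.measurable) fun s hs => ?_).le
    rw [h s hs, rearr_comp hU hg]
  · exact le_iSup_of_le (g ∘ U) (le_iSup_of_le (hg.comp hU.measurable)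
      (le_iSup_of_le (fun s _ => by rw [rearr_comp hU hg]) le_rfl))

lemma RINorm.bar_mono (X : RINorm μ) (hU : MeasurePreserving U μ unitMeasure) {f g : ℝ → ℝ≥0∞}
    (hf : Measurable f) (hg : Measurable g) (h : ∀ t ∈ Ioo (0 : ℝ) 1, f t ≤ g t) :
    X.bar f ≤ X.bar g := by
  rw [X.bar_eq hU hf, X.bar_eq hU hg]
  refine X.norm_mono _ _ (hf.comp hU.measurable) (hg.comp hU.measurable) ?_
  exact hU.quasiMeasurePreserving.ae (ae_unitMeasure_of_forall h)

lemma RINorm.bar_rearr [IsProbabilityMeasure μ] (X : RINorm μ)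
    (hU : MeasurePreserving U μ unitMeasure) {f : Ω → ℝ≥0∞}
    (hf : Measurable f) : X.bar (rearr μ f) = X.norm f := by
  rw [X.bar_eq hU (measurable_rearr _ _)]
  refine X.norm_rearr _ _ ((measurable_rearr _ _).comp hU.measurable) hf fun s _ => ?_
  rw [rearr_comp hU (measurable_rearr _ _), rearr_rearr]

lemma RINorm.bar_rearr_unit [IsProbabilityMeasure μ] (X : RINorm μ)
    (hU : MeasurePreserving U μ unitMeasure)
    {f : ℝ → ℝ≥0∞} (hf : Measurable f) : X.bar (rearr unitMeasure f) = X.bar f := by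
  rw [X.bar_eq hU hf, ← rearr_comp hU hf, X.bar_rearr hU (hf.comp hU.measurable)]

lemma RINorm.bar_le_norm_of_dist [IsProbabilityMeasure μ] (X : RINorm μ)
    (hU : MeasurePreserving U μ unitMeasure)
    {g : ℝ → ℝ≥0∞} {f : Ω → ℝ≥0∞} (hg : Measurable g) (hf : Measurable f)
    (h : ∀ τ, unitMeasure {t | τ < g t} ≤ μ {x | τ < f x}) : X.bar g ≤ X.norm f := by
  rw [← X.bar_rearr_unit hU hg, ← X.bar_rearr hU hf]
  exact X.bar_mono hU (measurable_rearr _ _) (measurable_rearr _ _) fun t _ =>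
    rearr_mono_of_dist h t

lemma RINorm.bar_le_bar_of_dist [IsProbabilityMeasure μ] (X : RINorm μ)
    (hU : MeasurePreserving U μ unitMeasure)
    {f g : ℝ → ℝ≥0∞} (hf : Measurable f) (hg : Measurable g)
    (h : ∀ τ, unitMeasure {t | τ < f t} ≤ unitMeasure {t | τ < g t}) : X.bar f ≤ X.bar g := by
  rw [X.bar_eq hU hg]
  refine X.bar_le_norm_of_dist hU hf (hg.comp hU.measurable) fun τ => (h τ).trans ?_
  exact (measure_lt_comp hU hg τ).ge

lemma RINorm.bar_add_le (X : RINorm μ) (hU : MeasurePreserving U μ unitMeasure)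
    {f g : ℝ → ℝ≥0∞} (hf : Measurable f) (hg : Measurable g) :
    X.bar (fun t => f t + g t) ≤ X.bar f + X.bar g := by
  rw [X.bar_eq hU hf, X.bar_eq hU hg, X.bar_eq hU (g := fun t => f t + g t) (hf.add hg)]
  exact X.norm_add_le _ _ (hf.comp hU.measurable) (hg.comp hU.measurable)

lemma RINorm.bar_smul (X : RINorm μ) (hU : MeasurePreserving U μ unitMeasure)
    {f : ℝ → ℝ≥0∞} (hf : Measurable f) (a : ℝ≥0) :
    X.bar (fun t => a * f t) = a * X.bar f := by
  rw [X.bar_eq hU hf, X.bar_eq hU (hf.const_mul _)]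
  exact X.norm_smul a _ (hf.comp hU.measurable)

lemma RINorm.bar_iSup (X : RINorm μ) (hU : MeasurePreserving U μ unitMeasure)
    {f : ℕ → ℝ → ℝ≥0∞} (hf : ∀ k, Measurable (f k)) (hmono : Monotone f) :
    X.bar (fun t => ⨆ k, f k t) = ⨆ k, X.bar (f k) := by
  rw [X.bar_eq hU (Measurable.iSup hf)]
  simp_rw [fun k => X.bar_eq hU (hf k)]
  exact X.norm_iSup (fun k => f k ∘ U) (fun k => (hf k).comp hU.measurable)
    fun i j hij x => hmono hij (U x)

lemma RINorm.norm_one_lt_top [IsProbabilityMeasure μ] (X : RINorm μ) : X.norm (fun _ => 1) < ∞ := by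
  simpa using X.norm_indicator_lt_top univ MeasurableSet.univ (measure_lt_top _ _)

lemma RINorm.norm_const (X : RINorm μ) (a : ℝ≥0) :
    X.norm (fun _ => (a : ℝ≥0∞)) = a * X.norm (fun _ => 1) := by
  simpa using X.norm_smul a (fun _ => 1) measurable_const

lemma RINorm.exists_lintegral_le [IsProbabilityMeasure μ] (X : RINorm μ) :
    ∃ C : ℝ≥0, ∀ f, Measurable f → ∫⁻ x, f x ∂μ ≤ C * X.norm f := by
  simpa using X.lintegral_le univ MeasurableSet.univ (measure_lt_top _ _)

lemma RINorm.exists_lintegral_le_bar [IsProbabilityMeasure μ] (X : RINorm μ)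
    (hU : MeasurePreserving U μ unitMeasure) :
    ∃ C : ℝ≥0, ∀ f, Measurable f → ∫⁻ x, f x ∂unitMeasure ≤ C * X.bar f := by
  obtain ⟨C, hC⟩ := X.exists_lintegral_le
  refine ⟨C, fun f hf => ?_⟩
  rw [X.bar_eq hU hf, ← hU.lintegral_comp hf]
  exact hC _ (hf.comp hU.measurable)

/-- The dilation operator has norm at most `2`. -/
lemma RINorm.bar_dilate [IsProbabilityMeasure μ] (X : RINorm μ)
    (hU : MeasurePreserving U μ unitMeasure)
    {g : ℝ → ℝ≥0∞} (hg : Measurable g) : X.bar (fun t => g (t / 2)) ≤ 2 * X.bar g := by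
  -- On `(0,1)` the dilated function only sees `g` on `(0,1/2)`. Its distribution is dominated by
  -- that of the sum of two disjoint translates of `h`, each of norm at most that of `g`.
  set h := (Ioo (0 : ℝ) (1 / 2)).indicator g with hh
  have hhm : Measurable h := hg.indicator measurableSet_Ioo
  have hhs : Measurable fun t => h (t - 1 / 2) := hhm.comp (measurable_id.sub_const _)
  have h0 : ∀ τ t, τ < h t → t ∈ Ioo (0 : ℝ) (1 / 2) := by
    intro τ t ht
    by_contra hc
    rw [hh, indicator_of_notMem hc] at ht
    exact not_lt_bot ht
  have hvol : ∀ τ, volume ((fun t : ℝ => t - 1 / 2) ⁻¹' {t | τ < h t}) = volume {t | τ < h t} :=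
    fun τ => (measurePreserving_sub_right volume (1 / 2 : ℝ)).measure_preimage
      (measurableSet_lt measurable_const hhm).nullMeasurableSet
  have hshift : X.bar (fun t => h (t - 1 / 2)) ≤ X.bar h := by
    refine X.bar_le_bar_of_dist hU hhs hhm fun τ => ?_
    have hsub : {t | τ < h t} ⊆ Ioo 0 1 := fun t ht =>
      ⟨(h0 τ t ht).1, (h0 τ t ht).2.trans (by norm_num)⟩
    rw [unitMeasure_apply, unitMeasure_apply, inter_eq_left.2 hsub, ← hvol τ]
    exact measure_mono inter_subset_left
  have hle : X.bar h ≤ X.bar g := X.bar_mono hU hhm hg fun t _ => indicator_le_self _ _ _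
  refine le_trans ?_ ((X.bar_add_le hU hhm hhs).trans
    ((add_le_add hle (hshift.trans hle)).trans_eq (two_mul _).symm))
  refine X.bar_le_bar_of_dist hU (hg.comp (measurable_id.div_const 2)) (hhm.add hhs) fun τ => ?_
  have hA : MeasurableSet {t | τ < h t} := measurableSet_lt measurable_const hhm
  have e1 : {t : ℝ | τ < g (t / 2)} ∩ Ioo 0 1 ⊆ (fun t : ℝ => (1 / 2) * t) ⁻¹' {t | τ < h t} := by
    rintro t ⟨ht, ht0, ht1⟩
    have : (1 / 2) * t ∈ Ioo (0 : ℝ) (1 / 2) := ⟨by linarith, by linarith⟩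
    rw [mem_preimage, mem_ofPred_eq, hh, indicator_of_mem this, one_div_mul_eq_div]
    exact ht
  have e2 : {t | τ < h t} ∪ ((fun t : ℝ => t - 1 / 2) ⁻¹' {t | τ < h t}) ⊆
      {t | τ < h t + h (t - 1 / 2)} ∩ Ioo 0 1 := by
    rintro t (ht | ht)
    · refine ⟨?_, (h0 τ t ht).1, (h0 τ t ht).2.trans (by norm_num)⟩
      exact lt_of_lt_of_le (show τ < h t from ht) le_self_add
    · have := h0 τ _ ht
      refine ⟨?_, by linarith [this.1], by linarith [this.2]⟩
      exact lt_of_lt_of_le (show τ < h (t - 1 / 2) from ht) le_add_self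
  rw [unitMeasure_apply, unitMeasure_apply]
  refine (measure_mono e1).trans (le_trans ?_ (measure_mono e2))
  have hB : MeasurableSet ((fun t : ℝ => t - 1 / 2) ⁻¹' {t | τ < h t}) :=
    hA.preimage (measurable_id.sub_const _)
  rw [measure_union _ hB, hvol, Real.volume_preimage_mul_left (by norm_num), ← two_mul]
  · simp
  · rw [Set.disjoint_left]
    intro t ht ht'
    have h1 := (h0 τ _ ht).2
    have h2 := (h0 τ _ ht').1
    linarith

end Norm

/-! ### Slopes of Lipschitz functions and a coarea inequality -/

section Coarea

variable {Ω : Type*} [MetricSpace Ω]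

/-- The largest slope of `f` between `x` and points at distance less than `ε`. -/
noncomputable def slopeSup (f : Ω → ℝ) (ε : ℝ) (x : Ω) : ℝ≥0∞ :=
  ⨆ (y : Ω) (_ : dist y x < ε ∧ y ≠ x), ENNReal.ofReal (|f x - f y| / dist x y)

lemma slopeSup_mono (f : Ω → ℝ) {ε δ : ℝ} (h : ε ≤ δ) (x : Ω) : slopeSup f ε x ≤ slopeSup f δ x :=
  iSup₂_le fun y hy => le_iSup₂_of_le y ⟨hy.1.trans_le h, hy.2⟩ le_rfl

lemma slopeSup_le {f : Ω → ℝ} {K : ℝ≥0} (hf : LipschitzWith K f) (ε : ℝ) (x : Ω) :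
    slopeSup f ε x ≤ K := by
  refine iSup₂_le fun y hy => ?_
  rw [← ENNReal.ofReal_coe_nnreal]
  refine ENNReal.ofReal_le_ofReal ?_
  rw [div_le_iff₀ (dist_pos.2 hy.2.symm), ← Real.dist_eq]
  exact hf.dist_le_mul x y

lemma sub_le_slopeSup_mul {f : Ω → ℝ} {K : ℝ≥0} (hf : LipschitzWith K f) {ε : ℝ} {x y : Ω}
    (h : dist x y < ε) : f y - f x ≤ (slopeSup f ε x).toReal * ε := by
  have hε : 0 < ε := dist_nonneg.trans_lt h
  rcases eq_or_ne y x with rfl | hyx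
  · simp only [sub_self]
    positivity
  · have h1 : ENNReal.ofReal (|f x - f y| / dist x y) ≤ slopeSup f ε x :=
      le_iSup₂_of_le (f := fun (y : Ω) (_ : dist y x < ε ∧ y ≠ x) =>
        ENNReal.ofReal (|f x - f y| / dist x y)) y ⟨by rwa [dist_comm], hyx⟩ le_rfl
    have hfin : slopeSup f ε x ≠ ⊤ := ne_top_of_le_ne_top ENNReal.coe_ne_top (slopeSup_le hf ε x)
    rw [ENNReal.ofReal_le_iff_le_toReal hfin, div_le_iff₀ (dist_pos.2 hyx.symm)] at h1
    calc f y - f x ≤ |f x - f y| := by rw [abs_sub_comm]; exact le_abs_self _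
      _ ≤ _ := h1
      _ ≤ _ := by gcongr

/-- The supremum runs over an uncountable set of `y`, so measurability is obtained from lower
semicontinuity: for fixed `y` both the constraint and the slope bound are open in `x`. -/
lemma isOpen_lt_slopeSup {f : Ω → ℝ} (hf : Continuous f) (ε : ℝ) (r : ℝ≥0∞) :
    IsOpen {x | r < slopeSup f ε x} := by
  have : {x | r < slopeSup f ε x} = ⋃ y, {x | (dist y x < ε ∧ y ≠ x) ∧
      r < ENNReal.ofReal (|f x - f y| / dist x y)} := by
    ext x
    simp only [slopeSup, mem_ofPred_eq, lt_iSup_iff, mem_iUnion, exists_prop]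
  rw [this]
  refine isOpen_iUnion fun y => ?_
  rw [isOpen_iff_mem_nhds]
  rintro x ⟨⟨h1, h2⟩, h3⟩
  have hc : ContinuousAt (fun z => ENNReal.ofReal (|f z - f y| / dist z y)) x := by
    refine ENNReal.continuous_ofReal.continuousAt.comp
      (ContinuousAt.div (by fun_prop) (by fun_prop) (dist_ne_zero.2 h2.symm))
  have hd : ContinuousAt (fun z => dist y z) x := by fun_prop
  filter_upwards [hc.eventually (lt_mem_nhds h3), hd.eventually (gt_mem_nhds h1),
    isOpen_ne.mem_nhds h2.symm] with z hz1 hz2 hz3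
  exact ⟨⟨hz2, fun h => hz3 h.symm⟩, hz1⟩

lemma gradMod_eq_iInf (f : Ω → ℝ) (x : Ω) :
    gradMod f x = ⨅ k : ℕ, slopeSup f (1 / ((k : ℝ) + 1)) x := by
  have h := HasBasis.limsup_eq_iInf_iSup (u := fun y => ENNReal.ofReal (|f x - f y| / dist x y))
    (nhdsWithin_hasBasis (Metric.nhds_basis_ball_inv_nat_succ (x := x)) {x}ᶜ)
  simp only [iInf_true] at h
  rw [gradMod, h]
  simp only [slopeSup, mem_inter_iff, Metric.mem_ball, mem_compl_iff, mem_singleton_iff, ne_eq]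

lemma gradMod_le {f : Ω → ℝ} {K : ℝ≥0} (hf : LipschitzWith K f) (x : Ω) : gradMod f x ≤ K := by
  rw [gradMod_eq_iInf]
  exact (iInf_le _ 0).trans (slopeSup_le hf _ x)

variable [MeasurableSpace Ω] [BorelSpace Ω]

lemma measurable_slopeSup {f : Ω → ℝ} (hf : Continuous f) (ε : ℝ) : Measurable (slopeSup f ε) :=
  measurable_of_Ioi fun r => (isOpen_lt_slopeSup hf ε r).measurableSet

lemma measurable_gradMod {f : Ω → ℝ} (hf : Continuous f) : Measurable (gradMod f) := by
  rw [funext (gradMod_eq_iInf f)]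
  exact Measurable.iInf fun k => measurable_slopeSup hf _

variable [SecondCountableTopology Ω] {μ : Measure Ω} [IsProbabilityMeasure μ]

/-- Tonelli in the pair (point, level). For fixed `x`, the levels whose superlevel set misses `x`
but comes within `ε` of it lie in an interval starting at `f x` of length `ε` times the slope at
scale `ε`. The gap `a' - a ≥ K ε` forces `f x > a` for every contributing `x`. -/
lemma lintegral_thickening_sub_le {f : Ω → ℝ} {K : ℝ≥0} (hf : LipschitzWith K f) {a a' b ε : ℝ}
    (hε : 0 < ε) (ha : K * ε ≤ a' - a) :
    ∫⁻ τ in Ioo a' b, (μ (Metric.thickening ε {x | τ < f x}) - μ {x | τ < f x}) ≤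
      ENNReal.ofReal ε * ∫⁻ x in {x | a < f x ∧ f x < b}, slopeSup f ε x ∂μ := by
  have hfc := hf.continuous
  set S : Set (Ω × ℝ) := {p | (a' < p.2 ∧ p.2 < b ∧ f p.1 ≤ p.2) ∧ ∃ y, dist p.1 y < ε ∧ p.2 < f y}
    with hS
  have hSm : MeasurableSet S := by
    refine MeasurableSet.inter ?_ ?_
    · refine (measurableSet_lt measurable_const measurable_snd).inter
        ((measurableSet_lt measurable_snd measurable_const).inter
          (measurableSet_le (hfc.measurable.comp measurable_fst) measurable_snd))
    · have : {p : Ω × ℝ | ∃ y, dist p.1 y < ε ∧ p.2 < f y} =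
          ⋃ y, {p : Ω × ℝ | dist p.1 y < ε ∧ p.2 < f y} := by ext; simp
      change MeasurableSet {p : Ω × ℝ | ∃ y, dist p.1 y < ε ∧ p.2 < f y}
      rw [this]
      refine IsOpen.measurableSet (isOpen_iUnion fun y => IsOpen.and ?_ ?_)
      · exact isOpen_lt (by fun_prop) (by fun_prop)
      · exact isOpen_lt (by fun_prop) (by fun_prop)
  have hA : ∀ τ, MeasurableSet {x | τ < f x} := fun τ =>
    measurableSet_lt measurable_const hfc.measurable
  have hB : MeasurableSet {x | a < f x ∧ f x < b} :=
    (hA a).inter (measurableSet_lt hfc.measurable measurable_const)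
  calc ∫⁻ τ in Ioo a' b, (μ (Metric.thickening ε {x | τ < f x}) - μ {x | τ < f x})
      ≤ ∫⁻ τ in Ioo a' b, μ ((fun x => (x, τ)) ⁻¹' S) := by
        refine setLIntegral_mono' measurableSet_Ioo fun τ hτ => ?_
        rw [← measure_sdiff (Metric.self_subset_thickening hε _) (hA τ).nullMeasurableSet
          (measure_ne_top _ _)]
        refine measure_mono fun x hx => ?_
        obtain ⟨y, hy, hxy⟩ := Metric.mem_thickening_iff.1 hx.1
        exact ⟨⟨hτ.1, hτ.2, not_lt.1 hx.2⟩, y, hxy, hy⟩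
    _ ≤ ∫⁻ τ, μ ((fun x => (x, τ)) ⁻¹' S) := setLIntegral_le_lintegral _ _
    _ = ∫⁻ x, volume (Prod.mk x ⁻¹' S) ∂μ := by
        rw [← Measure.prod_apply_symm hSm, Measure.prod_apply hSm]
    _ ≤ ∫⁻ x, {x | a < f x ∧ f x < b}.indicator
          (fun x => ENNReal.ofReal ε * slopeSup f ε x) x ∂μ := by
        refine lintegral_mono fun x => ?_
        rcases (Prod.mk x ⁻¹' S).eq_empty_or_nonempty with h | ⟨τ, ⟨h1, h2, h3⟩, y, hy, hτy⟩
        · simp [h]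
        have hfin : slopeSup f ε x ≠ ⊤ :=
          ne_top_of_le_ne_top ENNReal.coe_ne_top (slopeSup_le hf ε x)
        have hxB : x ∈ {x | a < f x ∧ f x < b} := by
          refine ⟨?_, lt_of_le_of_lt h3 h2⟩
          have hd := hf.dist_le_mul x y
          rw [Real.dist_eq] at hd
          have h4 := neg_le_abs (f x - f y)
          have h5 : (K : ℝ) * dist x y ≤ K * ε := by gcongr
          simp only at h1 hτy
          linarith
        rw [indicator_of_mem hxB]
        have hsub : Prod.mk x ⁻¹' S ⊆ Icc (f x) (f x + (slopeSup f ε x).toReal * ε) := by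
          rintro τ ⟨⟨-, -, h3⟩, y, hy, hτy⟩
          refine ⟨h3, ?_⟩
          have := sub_le_slopeSup_mul hf hy
          simp only at hτy
          linarith
        refine (measure_mono hsub).trans ?_
        rw [Real.volume_Icc, add_sub_cancel_left, ENNReal.ofReal_mul ENNReal.toReal_nonneg,
          ENNReal.ofReal_toReal hfin, mul_comm]
    _ = _ := by
        rw [lintegral_indicator hB, lintegral_const_mul _ (measurable_slopeSup hfc ε)]

/-- Let `ε = 1/(k+1)` tend to zero in the previous estimate: Fatou in the level on the perimeter
side, monotone decreasing convergence of bounded slopes on the gradient side. The margin `a' > a`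
absorbs `K ε` for large `k`. -/
lemma ofReal_mul_le_lintegral_gradMod_aux {f : Ω → ℝ} {K : ℝ≥0} (hf : LipschitzWith K f)
    {a a' b : ℝ} (haa : a < a') {J : ℝ≥0∞}
    (hJ : ∀ τ ∈ Ioo a b, J ≤ perimeter μ {x | τ < f x}) :
    ENNReal.ofReal (b - a') * J ≤ ∫⁻ x in {x | a < f x ∧ f x < b}, gradMod f x ∂μ := by
  have hfc := hf.continuous
  set ε : ℕ → ℝ := fun k => 1 / ((k : ℝ) + 1) with hε
  have hεpos : ∀ k, 0 < ε k := fun k => by positivity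
  have hεlim : Tendsto ε atTop (𝓝 0) := tendsto_one_div_add_atTop_nhds_zero_nat
  have hεanti : Antitone ε := fun i j hij => one_div_le_one_div_of_le (by positivity) (by
    have : (i : ℝ) ≤ j := by exact_mod_cast hij
    linarith)
  set F : ℕ → ℝ → ℝ≥0∞ := fun k τ =>
    (μ (Metric.thickening (ε k) {x | τ < f x}) - μ {x | τ < f x}) / ENNReal.ofReal (ε k) with hF
  have hanti1 : ∀ δ : ℝ, Antitone fun τ : ℝ => μ (Metric.thickening δ {x | τ < f x}) :=
    fun δ s t hst => measure_mono (Metric.thickening_subset_of_subset _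
      fun x (hx : t < f x) => show s < f x from hst.trans_lt hx)
  have hanti2 : Antitone fun τ : ℝ => μ {x | τ < f x} := fun s t hst =>
    measure_mono fun x (hx : t < f x) => show s < f x from hst.trans_lt hx
  have hFm : ∀ k, Measurable (F k) := fun k =>
    ((hanti1 _).measurable.sub hanti2.measurable).div_const _
  have hper : ∀ τ, perimeter μ {x | τ < f x} ≤ liminf (fun k => F k τ) atTop := by
    intro τ
    have ht : Tendsto ε atTop (𝓝[>] 0) :=
      tendsto_nhdsWithin_iff.2 ⟨hεlim, Eventually.of_forall fun k => hεpos k⟩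
    exact liminf_le_liminf_of_le (u := fun ε : ℝ =>
      (μ (Metric.thickening ε {x | τ < f x}) - μ {x | τ < f x}) / ENNReal.ofReal ε) ht
  have hlim : ∫⁻ x in {x | a < f x ∧ f x < b}, gradMod f x ∂μ =
      ⨅ k, ∫⁻ x in {x | a < f x ∧ f x < b}, slopeSup f (ε k) x ∂μ := by
    simp_rw [gradMod_eq_iInf]
    refine lintegral_iInf (fun k => measurable_slopeSup hfc _)
      (fun i j hij x => slopeSup_mono f (hεanti hij) x) ?_
    refine ne_top_of_le_ne_top ?_ (lintegral_mono fun x => slopeSup_le hf _ x)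
    simp [ENNReal.mul_eq_top]
  rw [hlim]
  refine le_iInf fun k₀ => ?_
  calc ENNReal.ofReal (b - a') * J = ∫⁻ _ in Ioo a' b, J := by simp [mul_comm]
    _ ≤ ∫⁻ τ in Ioo a' b, liminf (fun k => F k τ) atTop :=
        setLIntegral_mono' measurableSet_Ioo fun τ hτ =>
          (hJ τ ⟨haa.trans hτ.1, hτ.2⟩).trans (hper τ)
    _ ≤ liminf (fun k => ∫⁻ τ in Ioo a' b, F k τ) atTop := lintegral_liminf_le hFm
    _ ≤ _ := by
        refine liminf_le_of_frequently_le' (Eventually.frequently ?_)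
        have hKlim : Tendsto (fun k => K * ε k) atTop (𝓝 (K * 0)) := hεlim.const_mul _
        rw [mul_zero] at hKlim
        filter_upwards [eventually_ge_atTop k₀,
          hKlim.eventually (ge_mem_nhds (sub_pos.2 haa))] with k hk hKk
        have := lintegral_thickening_sub_le (μ := μ) hf (b := b) (hεpos k) hKk
        simp only [hF, div_eq_mul_inv]
        rw [lintegral_mul_const _ (show Measurable fun τ : ℝ =>
          μ (Metric.thickening (ε k) {x | τ < f x}) - μ {x | τ < f x} from
          (hanti1 _).measurable.sub hanti2.measurable), ← div_eq_mul_inv]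
        refine ENNReal.div_le_of_le_mul' (this.trans ?_)
        gcongr
        exact slopeSup_mono f (hεanti hk) _

/-- A weak form of the coarea inequality. -/
lemma ofReal_mul_le_lintegral_gradMod {f : Ω → ℝ} {K : ℝ≥0} (hf : LipschitzWith K f)
    {a b : ℝ} {J : ℝ≥0∞} (hJ : ∀ τ ∈ Ioo a b, J ≤ perimeter μ {x | τ < f x}) :
    ENNReal.ofReal (b - a) * J ≤ ∫⁻ x in {x | a < f x ∧ f x < b}, gradMod f x ∂μ := by
  rcases le_or_gt b a with hab | hab
  · simp [ENNReal.ofReal_of_nonpos (sub_nonpos.2 hab)]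
  have hc : Tendsto (fun a' => ENNReal.ofReal (b - a') * J) (𝓝[>] a)
      (𝓝 (ENNReal.ofReal (b - a) * J)) := by
    refine ENNReal.Tendsto.mul_const (ENNReal.tendsto_ofReal ?_) (Or.inl ?_)
    · exact (tendsto_const_nhds.sub tendsto_id).mono_left nhdsWithin_le_nhds
    · simpa using hab
  refine le_of_tendsto hc ?_
  filter_upwards [self_mem_nhdsWithin] with a' ha'
  exact ofReal_mul_le_lintegral_gradMod_aux hf ha' hJ

end Coarea

/-! ### Profile estimates and the Hardy operator -/

/-- The properties of a concave profile that are used in the estimates on `(0,1)`. -/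
structure ProfileBounds (I : ℝ → ℝ≥0∞) : Prop where
  measurable : Measurable I
  pos : ∀ t ∈ Ioo (0 : ℝ) 1, I t ≠ 0
  ne_top : ∀ t ∈ Ioo (0 : ℝ) 1, I t ≠ ∞
  mono : ∀ s t : ℝ, 0 < s → s ≤ t → t ≤ 1 / 2 → I s ≤ I t
  ratio : ∀ s t : ℝ, 0 < s → s ≤ t → t < 1 → I t * ENNReal.ofReal s ≤ I s * ENNReal.ofReal t

lemma ProfileBounds.le_two_mul {I : ℝ → ℝ≥0∞} (hI : ProfileBounds I) {s : ℝ} (hs : 0 < s)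
    (hs1 : s ≤ 1 / 4) : I (2 * s) ≤ 2 * I s := by
  have h := hI.ratio s (2 * s) hs (by linarith) (by linarith)
  rw [ENNReal.ofReal_mul (by norm_num), ← mul_assoc,
    ENNReal.mul_le_mul_iff_left (by simpa using hs) ENNReal.ofReal_ne_top] at h
  simpa [mul_comm] using h

lemma hardyOp_antitone (I f : ℝ → ℝ≥0∞) : Antitone (hardyOp I f) :=
  fun _ _ hst => lintegral_mono_set (Ioo_subset_Ioo_left hst)

lemma measurable_hardyOp (I f : ℝ → ℝ≥0∞) : Measurable (hardyOp I f) :=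
  (hardyOp_antitone I f).measurable

lemma lintegral_Ioo_sub (f : ℝ → ℝ≥0∞) (a b : ℝ) :
    ∫⁻ t in Ioo a b, f (t - a) = ∫⁻ t in Ioo 0 (b - a), f t := by
  have := (measurePreserving_sub_right volume a).setLIntegral_comp_preimage_emb
    (MeasurableEquiv.subRight a).measurableEmbedding f (Ioo 0 (b - a))
  rw [← this]
  congr 2
  ext t
  simp

/-! ### Measure of level strips and piecewise rearrangement -/

section HardyToPoincare

variable {Ω : Type*} [MeasurableSpace Ω] {μ : Measure Ω}

/-- The measure of the part of `{p > a}` below the next level is controlled by the measures of the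
level sets. -/
lemma measure_between_le {p : Ω → ℝ} (hp : Measurable p) {a b s : ℝ} (hs : 0 ≤ s)
    (ha : μ {x | a < p x} ≤ ENNReal.ofReal (2 * s))
    (hb : ∀ τ, a ≤ τ → τ < b → ENNReal.ofReal s ≤ μ {x | τ < p x}) :
    μ {x | a < p x ∧ p x < b} ≤ ENNReal.ofReal s := by
  -- The lower bound on superlevel sets is available only below `b`, so the strip is exhausted by `a
  -- < p ≤ u n`, of measure at most `2s - s`.
  obtain ⟨u, hu, hu', hlim⟩ := exists_seq_strictMono_tendsto b
  have hun : {x | a < p x ∧ p x < b} = ⋃ n, {x | a < p x ∧ p x ≤ u n} := by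
    ext x
    simp only [mem_ofPred_eq, mem_iUnion]
    constructor
    · rintro ⟨h1, h2⟩
      obtain ⟨n, hn⟩ := ((tendsto_order.1 hlim).1 _ h2).exists
      exact ⟨n, h1, hn.le⟩
    · rintro ⟨n, h1, h2⟩
      exact ⟨h1, h2.trans_lt (hu' n)⟩
  rw [hun, Monotone.measure_iUnion]
  · refine iSup_le fun n => ?_
    rcases lt_or_ge (u n) a with h | h
    · have : {x | a < p x ∧ p x ≤ u n} = ∅ := by
        ext x
        simp only [mem_ofPred_eq, mem_empty_iff_false, iff_false, not_and, not_le]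
        exact fun h1 => h.trans h1
      simp [this]
    · have h1 : μ {x | a < p x ∧ p x ≤ u n} + μ {x | u n < p x} ≤ ENNReal.ofReal (2 * s) := by
        rw [← measure_union _ (measurableSet_lt measurable_const hp)]
        · refine (measure_mono ?_).trans ha
          rintro x (hx | hx)
          · exact hx.1
          · exact lt_of_le_of_lt h hx
        · rw [Set.disjoint_left]
          exact fun x hx (hx' : u n < p x) => hx'.not_ge hx.2
      have h2 := (add_le_add_right (hb (u n) h (hu' n)) _).trans h1
      rw [two_mul, ENNReal.ofReal_add hs hs] at h2
      exact (ENNReal.add_le_add_iff_right ENNReal.ofReal_ne_top).1 h2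
  · intro m n hmn x hx
    exact ⟨hx.1, hx.2.trans (hu.monotone hmn)⟩

variable [IsProbabilityMeasure μ]

lemma rearr_ne_top {f : Ω → ℝ≥0∞} (hf : Measurable f) (hfin : ∀ x, f x ≠ ∞) {s : ℝ} (hs : 0 < s) :
    rearr μ f s ≠ ∞ := by
  intro htop
  have h1 : ∀ n : ℕ, ENNReal.ofReal s ≤ μ {x | (n : ℝ≥0∞) < f x} := fun n =>
    (lt_rearr_iff.1 (htop ▸ ENNReal.natCast_lt_top n)).le
  have h2 : ⋂ n : ℕ, {x | (n : ℝ≥0∞) < f x} = ∅ := by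
    refine eq_empty_iff_forall_notMem.2 fun x hx => ?_
    obtain ⟨n, hn⟩ := ENNReal.exists_nat_gt (hfin x)
    exact lt_asymm hn (mem_iInter.1 hx n)
  have h3 := tendsto_measure_iInter_atTop (μ := μ) (s := fun n : ℕ => {x | (n : ℝ≥0∞) < f x})
    (fun n => (measurableSet_lt measurable_const hf).nullMeasurableSet)
    (fun i j hij x (hx : (j : ℝ≥0∞) < f x) =>
      show (i : ℝ≥0∞) < f x from lt_of_le_of_lt (by exact_mod_cast hij) hx)
    ⟨0, measure_ne_top _ _⟩
  rw [h2, measure_empty] at h3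
  have := ge_of_tendsto' h3 h1
  simp [hs.not_ge] at this

/-- Put decreasing rearrangements of the restrictions of `w` to disjoint sets `B j` side by side,
on intervals of length at least `μ (B j)`. -/
lemma exists_piecewise_rearr {w : Ω → ℝ≥0∞} (hw : Measurable w) {B : ℕ → Set Ω}
    (hB : ∀ j, MeasurableSet (B j)) (hd : Pairwise (Function.onFun Disjoint B)) {a b : ℕ → ℝ}
    (hab : ∀ j, b j - a j ≤ 1) (hμ : ∀ j, μ (B j) ≤ ENNReal.ofReal (b j - a j)) :
    ∃ h : ℝ → ℝ≥0∞, Measurable h ∧ Function.support h ⊆ ⋃ j, Ioo (a j) (b j) ∧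
      (∀ τ, unitMeasure {t | τ < h t} ≤ μ {x | τ < w x}) ∧
      ∀ j, ∫⁻ x in B j, w x ∂μ ≤ ∫⁻ t in Ioo (a j) (b j), h t := by
  set φ : ℕ → ℝ → ℝ≥0∞ := fun j => (Ioo (a j) (b j)).indicator
    fun t => rearr μ ((B j).indicator w) (t - a j) with hφ
  have hφm : ∀ j, Measurable (φ j) := fun j =>
    ((measurable_rearr μ _).comp (measurable_id.sub_const _)).indicator measurableSet_Ioo
  refine ⟨fun t => ⨆ j, φ j t, Measurable.iSup hφm, ?_, ?_, ?_⟩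
  · intro t ht
    by_contra hc
    refine ht ?_
    simp only [mem_iUnion, not_exists] at hc
    simp [hφ, indicator_of_notMem (hc _)]
  · intro τ
    have h1 : ∀ j, volume {t | τ < φ j t} ≤ μ (B j ∩ {x | τ < w x}) := by
      intro j
      set m := μ (B j ∩ {x | τ < w x}) with hm
      have hmt : m ≠ ∞ := measure_ne_top _ _
      have : {t | τ < φ j t} ⊆ Ioo (a j) (a j + m.toReal) := by
        intro t (ht : τ < φ j t)
        by_cases htJ : t ∈ Ioo (a j) (b j)
        · rw [hφ] at ht
          simp only [indicator_of_mem htJ, lt_rearr_iff] at ht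
          have h2 : {x | τ < (B j).indicator w x} = B j ∩ {x | τ < w x} := by
            ext x
            by_cases hx : x ∈ B j <;> simp [hx]
          rw [h2, ENNReal.ofReal_lt_iff_lt_toReal (sub_nonneg.2 htJ.1.le) hmt] at ht
          exact ⟨htJ.1, by linarith⟩
        · simp [hφ, indicator_of_notMem htJ] at ht
      refine (measure_mono this).trans ?_
      rw [Real.volume_Ioo, add_sub_cancel_left, ENNReal.ofReal_toReal hmt]
    have h2 : {t | τ < ⨆ j, φ j t} = ⋃ j, {t | τ < φ j t} := by
      ext t
      simp [lt_iSup_iff]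
    calc unitMeasure {t | τ < ⨆ j, φ j t} ≤ volume {t | τ < ⨆ j, φ j t} := by
          rw [unitMeasure_apply]; exact measure_mono inter_subset_left
      _ ≤ ∑' j, volume {t | τ < φ j t} := h2 ▸ measure_iUnion_le _
      _ ≤ ∑' j, μ (B j ∩ {x | τ < w x}) := ENNReal.tsum_le_tsum h1
      _ = μ (⋃ j, B j ∩ {x | τ < w x}) := by
          refine (measure_iUnion (fun i j hij => ?_) fun j =>
            (hB j).inter (measurableSet_lt measurable_const hw)).symm
          exact (hd hij).mono inter_subset_left inter_subset_left
      _ ≤ _ := measure_mono (iUnion_subset fun j => inter_subset_right)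
  · intro j
    calc ∫⁻ x in B j, w x ∂μ = ∫⁻ x, (B j).indicator w x ∂μ := (lintegral_indicator (hB j) _).symm
      _ = ∫⁻ t in Ioo 0 (b j - a j), rearr μ ((B j).indicator w) t :=
          (lintegral_rearr_Ioo (hw.indicator (hB j)) (fun x hx => indicator_of_notMem hx _)
            (hab j) (hμ j)).symm
      _ = ∫⁻ t in Ioo (a j) (b j), rearr μ ((B j).indicator w) (t - a j) :=
          (lintegral_Ioo_sub _ _ _).symm
      _ ≤ _ := by
          refine setLIntegral_mono' measurableSet_Ioo fun t ht => le_iSup_of_le j ?_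
          rw [hφ]
          simp [indicator_of_mem ht]

end HardyToPoincare

/-! ### Medians and monotonicity of the gradient -/

section Auxiliary

variable {Ω : Type*} [MeasurableSpace Ω] {μ : Measure Ω}

lemma ofReal_lt_rearr_ofReal_iff {p : Ω → ℝ} {s τ : ℝ} (hτ : 0 ≤ τ) :
    ENNReal.ofReal τ < rearr μ (fun x => ENNReal.ofReal (p x)) s ↔
      ENNReal.ofReal s < μ {x | τ < p x} := by
  rw [lt_rearr_iff]
  simp only [ENNReal.ofReal_lt_ofReal_iff_of_nonneg hτ]

/-- Take the least point where the distribution function of `f` reaches `1/2`; right-continuity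
handles the upper tail, and exhaustion from the left the lower one. -/
lemma exists_median [IsProbabilityMeasure μ] {f : Ω → ℝ} (hf : Measurable f) :
    ∃ m : ℝ, μ {x | m < f x} ≤ 1 / 2 ∧ μ {x | f x < m} ≤ 1 / 2 := by
  set ν := μ.map f with hν
  have : IsProbabilityMeasure ν := Measure.isProbabilityMeasure_map hf.aemeasurable
  set F := ProbabilityTheory.cdf ν with hF
  set S : Set ℝ := {t | 1 / 2 ≤ F t} with hS
  have hne : S.Nonempty :=
    ((ProbabilityTheory.tendsto_cdf_atTop ν).eventually (le_mem_nhds (by norm_num))).exists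
  have hbdd : BddBelow S := by
    obtain ⟨b, hb⟩ := ((ProbabilityTheory.tendsto_cdf_atBot ν).eventually
      (gt_mem_nhds (show (0 : ℝ) < 1 / 2 by norm_num))).exists
    refine ⟨b, fun t (ht : 1 / 2 ≤ F t) => ?_⟩
    by_contra! hlt
    exact absurd (F.mono hlt.le) (not_le.2 (hb.trans_le ht))
  set m := sInf S with hm
  have hFm : 1 / 2 ≤ F m := by
    rw [← F.iInf_Ioi_eq m]
    refine le_ciInf fun ⟨t, ht⟩ => ?_
    obtain ⟨u, hu, hut⟩ := exists_lt_of_csInf_lt hne ht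
    exact le_trans (show 1 / 2 ≤ F u from hu) (F.mono hut.le)
  have half : ENNReal.ofReal (1 / 2) = 1 / 2 := by
    rw [ENNReal.ofReal_div_of_pos (by norm_num)]
    simp
  refine ⟨m, ?_, ?_⟩
  · have e : μ {x | m < f x} = ν (Ioi m) := (Measure.map_apply hf measurableSet_Ioi).symm
    rw [e, ← half, ← compl_Iic, prob_compl_eq_one_sub measurableSet_Iic,
      ← ProbabilityTheory.ofReal_cdf,
      ← ENNReal.ofReal_one, ← ENNReal.ofReal_sub _ (ProbabilityTheory.cdf_nonneg _ _)]
    refine ENNReal.ofReal_le_ofReal ?_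
    linarith
  · have e : μ {x | f x < m} = ν (Iio m) := (Measure.map_apply hf measurableSet_Iio).symm
    obtain ⟨u, hu, hu', hlim⟩ := exists_seq_strictMono_tendsto m
    have hun : Iio m = ⋃ n, Iic (u n) := by
      ext x
      simp only [mem_Iio, mem_iUnion, mem_Iic]
      constructor
      · intro hx
        obtain ⟨n, hn⟩ := ((tendsto_order.1 hlim).1 _ hx).exists
        exact ⟨n, hn.le⟩
      · rintro ⟨n, hn⟩
        exact hn.trans_lt (hu' n)
    rw [e, hun, Monotone.measure_iUnion fun i j hij => Iic_subset_Iic.2 (hu.monotone hij)]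
    refine iSup_le fun n => ?_
    rw [← ProbabilityTheory.ofReal_cdf, ← half]
    refine ENNReal.ofReal_le_ofReal (le_of_not_ge fun hc => ?_)
    exact absurd (csInf_le hbdd hc) (not_le.2 (hu' n))

lemma gradMod_mono {Ω : Type*} [MetricSpace Ω] {f g : Ω → ℝ}
    (h : ∀ x y, |f x - f y| ≤ |g x - g y|) (x : Ω) :
    gradMod f x ≤ gradMod g x := by
  refine limsup_le_limsup (Eventually.of_forall fun y => ENNReal.ofReal_le_ofReal ?_)
  exact div_le_div_of_nonneg_right (h x y) dist_nonneg

end Auxiliary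

/-! ### From the Hardy inequality to the Poincaré inequality -/

section HardyToPoincare

variable {Ω : Type*} [MetricSpace Ω] [MeasurableSpace Ω] [BorelSpace Ω]
  [SecondCountableTopology Ω] {μ : Measure Ω} [IsProbabilityMeasure μ]

/-- The pointwise form of the symmetrization inequality: `p*` is dominated by a Hardy transform of
a function whose distribution is dominated by that of the gradient. -/
lemma exists_rearr_le_hardyOp {I : ℝ → ℝ≥0∞} (hI : ProfileBounds I)
    (hper : ∀ A : Set Ω, MeasurableSet A → ∀ t : ℝ, μ A = ENNReal.ofReal t → I t ≤ perimeter μ A)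
    {p : Ω → ℝ} {K : ℝ≥0} (hp : LipschitzWith K p) (hsupp : μ {x | 0 < p x} ≤ 1 / 2) :
    ∃ h : ℝ → ℝ≥0∞, Measurable h ∧ Function.support h ⊆ Ioo 0 (1 / 2) ∧
      (∀ τ, unitMeasure {t | τ < h t} ≤ μ {x | τ < gradMod p x}) ∧
      ∀ t ∈ Ioo (0 : ℝ) 1,
        rearr μ (fun x => ENNReal.ofReal (p x)) t ≤ 2 * hardyOp I h (t / 2) := by
  have hpm : Measurable p := hp.continuous.measurable
  set P : Ω → ℝ≥0∞ := fun x => ENNReal.ofReal (p x) with hP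
  have hPm : Measurable P := hpm.ennreal_ofReal
  -- The grid starts at `s 0 = 1/2`, where the support hypothesis makes the rearrangement vanish, so
  -- the telescoping sum of level gaps starts from zero.
  set s : ℕ → ℝ := fun j => (1 / 2) ^ (j + 1) with hs
  have hs0 : ∀ j, 0 < s j := fun j => by positivity
  have hsucc : ∀ j, s j = 2 * s (j + 1) := fun j => by simp only [hs]; ring
  have hs_half : ∀ j, s j ≤ 1 / 2 := fun j => by
    have : ((1 : ℝ) / 2) ^ j ≤ 1 := pow_le_one₀ (by norm_num) (by norm_num)
    simp only [hs, pow_succ]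
    linarith
  have hs_anti : Antitone s := antitone_nat_of_succ_le fun j => by
    have := hsucc j
    have := hs0 (j + 1)
    linarith
  set r : ℕ → ℝ≥0∞ := fun j => rearr μ P (s j) with hr
  have hrt : ∀ j, r j ≠ ∞ := fun j => rearr_ne_top hPm (fun _ => ENNReal.ofReal_ne_top) (hs0 j)
  have hr_mono : Monotone r := fun i j hij => rearr_antitone μ P (hs_anti hij)
  have hr0 : r 0 = 0 := by
    rw [← nonpos_iff_eq_zero, hr, rearr_le_iff]
    simp only [hP, ENNReal.ofReal_pos]
    refine hsupp.trans_eq ?_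
    rw [show s 0 = 1 / 2 by simp [hs], ENNReal.ofReal_div_of_pos (by norm_num)]
    simp
  set a : ℕ → ℝ := fun j => (r j).toReal with ha
  have ha0 : ∀ j, 0 ≤ a j := fun j => ENNReal.toReal_nonneg
  have har : ∀ j, ENNReal.ofReal (a j) = r j := fun j => ENNReal.ofReal_toReal (hrt j)
  have ha_mono : Monotone a := fun i j hij => ENNReal.toReal_mono (hrt j) (hr_mono hij)
  have hlow : ∀ j τ, 0 ≤ τ → τ < a j → ENNReal.ofReal (s j) < μ {x | τ < p x} := by
    intro j τ hτ hj
    rw [← ofReal_lt_rearr_ofReal_iff hτ]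
    change ENNReal.ofReal τ < r j
    rwa [← har, ENNReal.ofReal_lt_ofReal_iff_of_nonneg hτ]
  have hupp : ∀ j τ, a j ≤ τ → μ {x | τ < p x} ≤ ENNReal.ofReal (s j) := by
    intro j τ hj
    rw [← not_lt, ← ofReal_lt_rearr_ofReal_iff ((ha0 j).trans hj), not_lt]
    change r j ≤ _
    rw [← har]
    exact ENNReal.ofReal_le_ofReal hj
  set B : ℕ → Set Ω := fun j => {x | a j < p x ∧ p x < a (j + 1)} with hB
  have hBm : ∀ j, MeasurableSet (B j) := fun j =>
    (measurableSet_lt measurable_const hpm).inter (measurableSet_lt hpm measurable_const)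
  have hBd : Pairwise (Function.onFun Disjoint B) := by
    refine (pairwise_disjoint_on B).2 fun i j hij => ?_
    rw [Set.disjoint_left]
    exact fun x hx hx' => lt_irrefl _ ((hx.2.trans_le (ha_mono hij)).trans hx'.1)
  have hBμ : ∀ j, μ (B j) ≤ ENNReal.ofReal (s j - s (j + 1)) := by
    intro j
    rw [show s j - s (j + 1) = s (j + 1) by linarith [hsucc j]]
    refine measure_between_le hpm (hs0 _).le ?_ fun τ h1 h2 => (hlow _ τ ((ha0 j).trans h1) h2).le
    rw [← hsucc]
    exact hupp j _ le_rfl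
  have hBlen : ∀ j, s j - s (j + 1) ≤ 1 := fun j => by linarith [hs_half j, hs0 (j + 1)]
  obtain ⟨h, hhm, hhs, hhd, hhE⟩ := exists_piecewise_rearr (measurable_gradMod hp.continuous)
    hBm hBd hBlen hBμ
  refine ⟨h, hhm, hhs.trans (iUnion_subset fun j => Ioo_subset_Ioo (hs0 _).le (hs_half j)), hhd, ?_⟩
  -- Isoperimetry supplies `I` at the left end `s (j + 1)`, while bringing `1/I` inside the integral
  -- needs `I` at the right end `s j`. Doubling of the profile reconciles them at the cost of the
  -- factor 2.
  have hstep : ∀ j, ENNReal.ofReal (a (j + 1) - a j) ≤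
      2 * ∫⁻ t in Ioo (s (j + 1)) (s j), h t / I t := by
    intro j
    have hmem : s (j + 1) ∈ Ioo (0 : ℝ) 1 := ⟨hs0 _, by linarith [hs_half (j + 1)]⟩
    have hmem' : s j ∈ Ioo (0 : ℝ) 1 := ⟨hs0 _, by linarith [hs_half j]⟩
    have h1 : ENNReal.ofReal (a (j + 1) - a j) * I (s (j + 1)) ≤
        ∫⁻ x in B j, gradMod p x ∂μ := by
      refine ofReal_mul_le_lintegral_gradMod hp fun τ hτ => ?_
      have hτ0 : 0 ≤ τ := (ha0 j).trans hτ.1.le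
      have hfin : μ {x | τ < p x} ≠ ∞ := measure_ne_top _ _
      have l1 := (hlow _ τ hτ0 hτ.2).le
      have l2 := hupp _ τ hτ.1.le
      rw [ENNReal.ofReal_le_iff_le_toReal hfin] at l1
      have l3 : (μ {x | τ < p x}).toReal ≤ 1 / 2 :=
        (ENNReal.toReal_le_of_le_ofReal (hs0 j).le l2).trans (hs_half j)
      exact (hI.mono _ _ (hs0 _) l1 l3).trans
        (hper _ (measurableSet_lt measurable_const hpm) _ (ENNReal.ofReal_toReal hfin).symm)
    have h2 : I (s j) ≤ 2 * I (s (j + 1)) := by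
      rw [hsucc]
      exact hI.le_two_mul (hs0 _) (by linarith [hsucc j, hs_half j])
    have h3 : (∫⁻ x in B j, gradMod p x ∂μ) / I (s j) ≤
        ∫⁻ t in Ioo (s (j + 1)) (s j), h t / I t := by
      calc (∫⁻ x in B j, gradMod p x ∂μ) / I (s j)
          ≤ (∫⁻ t in Ioo (s (j + 1)) (s j), h t) / I (s j) := by gcongr; exact hhE j
        _ = ∫⁻ t in Ioo (s (j + 1)) (s j), h t / I (s j) := by
            simp only [div_eq_mul_inv]
            rw [lintegral_mul_const _ hhm]
        _ ≤ _ := by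
            refine setLIntegral_mono' measurableSet_Ioo fun t ht => ?_
            gcongr
            exact hI.mono _ _ ((hs0 _).trans ht.1) ht.2.le (hs_half j)
    calc ENNReal.ofReal (a (j + 1) - a j)
        = ENNReal.ofReal (a (j + 1) - a j) * I (s (j + 1)) / I (s (j + 1)) :=
          (ENNReal.mul_div_cancel_right (hI.pos _ hmem) (hI.ne_top _ hmem)).symm
      _ ≤ (∫⁻ x in B j, gradMod p x ∂μ) / I (s (j + 1)) := by gcongr
      _ ≤ 2 * ((∫⁻ x in B j, gradMod p x ∂μ) / I (s j)) := by
          simp only [div_eq_mul_inv]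
          rw [mul_left_comm]
          gcongr
          rw [ENNReal.inv_le_iff_inv_le, ENNReal.mul_inv (by simp) (by simp), inv_inv, mul_comm,
            ← div_eq_mul_inv]
          exact ENNReal.div_le_of_le_mul' h2
      _ ≤ _ := by gcongr
  have hsum : ∀ j, r j ≤ 2 * hardyOp I h (s j) := by
    intro j
    induction j with
    | zero => simp [hr0]
    | succ j ih =>
      have e1 : r (j + 1) = r j + ENNReal.ofReal (a (j + 1) - a j) := by
        rw [← har, ← har j, ← ENNReal.ofReal_add (ha0 j) (sub_nonneg.2 (ha_mono j.le_succ))]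
        congr 1
        ring
      rw [e1]
      refine (add_le_add ih (hstep j)).trans ?_
      rw [← mul_add]
      gcongr
      rw [hardyOp, hardyOp, ← lintegral_union measurableSet_Ioo]
      · refine lintegral_mono_set (union_subset ?_ ?_)
        · exact Ioo_subset_Ioo_left (hs_anti j.le_succ)
        · exact Ioo_subset_Ioo_right ((hs_half j).trans (by norm_num))
      · rw [Set.disjoint_left]
        exact fun t ht ht' => lt_asymm ht.1 ht'.2
  intro t ht
  -- Chosen so that `s j < t ≤ 2 * s j`; the second inequality is why the Hardy transform is
  -- evaluated at `t / 2`.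
  obtain ⟨j, hj1, hj2⟩ := exists_nat_pow_near_of_lt_one ht.1 ht.2.le
    (by norm_num : (0 : ℝ) < 1 / 2) (by norm_num)
  have ht2 : t / 2 ≤ s j := by
    simp only [hs, pow_succ]
    linarith
  calc rearr μ P t ≤ r j := rearr_antitone μ P (show s j ≤ t from hj1.le)
    _ ≤ 2 * hardyOp I h (s j) := hsum j
    _ ≤ _ := by gcongr; exact hardyOp_antitone I h ht2

lemma exists_norm_le_of_hardyBounded {I : ℝ → ℝ≥0∞} (hI : ProfileBounds I)
    (hper : ∀ A : Set Ω, MeasurableSet A → ∀ t : ℝ, μ A = ENNReal.ofReal t → I t ≤ perimeter μ A)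
    {U : Ω → ℝ} (hU : MeasurePreserving U μ unitMeasure) {X Y : RINorm μ}
    (hH : HardyBounded I X Y) :
    ∃ C : ℝ≥0, ∀ (p : Ω → ℝ) (K : ℝ≥0), LipschitzWith K p → μ {x | 0 < p x} ≤ 1 / 2 →
      Y.norm (fun x => ENNReal.ofReal (p x)) ≤ C * X.norm (gradMod p) := by
  obtain ⟨C, hC⟩ := hH
  -- One factor 2 comes from the pointwise bound, the other from the dilation `t ↦ t / 2`.
  refine ⟨4 * C, fun p K hp hsupp => ?_⟩
  obtain ⟨h, hhm, hhs, hhd, hle⟩ := exists_rearr_le_hardyOp hI hper hp hsupp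
  have hpm : Measurable fun x => ENNReal.ofReal (p x) := hp.continuous.measurable.ennreal_ofReal
  have hgm := measurable_gradMod hp.continuous
  have hX : X.bar h ≤ X.norm (gradMod p) := X.bar_le_norm_of_dist hU hhm hgm hhd
  have hfin : X.norm (gradMod p) < ∞ := by
    refine (X.norm_mono _ _ hgm measurable_const (ae_of_all _ (gradMod_le hp))).trans_lt ?_
    rw [X.norm_const]
    exact ENNReal.mul_lt_top ENNReal.coe_lt_top X.norm_one_lt_top
  have hGm := measurable_hardyOp I h
  have hG2 : Measurable fun t => hardyOp I h (t / 2) := hGm.comp (measurable_id.div_const 2)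
  calc Y.norm (fun x => ENNReal.ofReal (p x))
      = Y.bar (rearr μ fun x => ENNReal.ofReal (p x)) := (Y.bar_rearr hU hpm).symm
    _ ≤ Y.bar (fun t => (2 : ℝ≥0) * hardyOp I h (t / 2)) :=
        Y.bar_mono hU (measurable_rearr _ _) (hG2.const_mul _) hle
    _ = 2 * Y.bar (fun t => hardyOp I h (t / 2)) := by rw [Y.bar_smul hU hG2]; simp
    _ ≤ 2 * (2 * Y.bar (hardyOp I h)) := by gcongr; exact Y.bar_dilate hU hGm
    _ ≤ 2 * (2 * (C * X.norm (gradMod p))) := by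
        gcongr
        exact (hC h hhm (hX.trans_lt hfin) hhs).trans (by gcongr)
    _ = _ := by
        push_cast
        ring

/-- Both `f - m` and `m - f`, with `m` a median, are positive on at most half of the space. Passing
from `m` to the mean costs a multiple of the same norm, since the two differ by at most the `L¹`
norm of `f - m`, which the norm of `Y` controls. -/
theorem poincare_of_hardyBounded {I : ℝ → ℝ≥0∞} (hI : ProfileBounds I)
    (hper : ∀ A : Set Ω, MeasurableSet A → ∀ t : ℝ, μ A = ENNReal.ofReal t → I t ≤ perimeter μ A)
    {U : Ω → ℝ} (hU : MeasurePreserving U μ unitMeasure) {X Y : RINorm μ}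
    (hH : HardyBounded I X Y) : Poincare X Y := by
  obtain ⟨C, hC⟩ := exists_norm_le_of_hardyBounded hI hper hU hH
  obtain ⟨D, hD⟩ := Y.exists_lintegral_le
  have hY1 : Y.norm (fun _ => 1) ≠ ∞ := Y.norm_one_lt_top.ne
  refine ⟨2 * C * (1 + D * (Y.norm fun _ => 1).toNNReal), ?_⟩
  rintro f ⟨K, hf⟩
  have hfm : Measurable f := hf.continuous.measurable
  obtain ⟨m, hm1, hm2⟩ := exists_median (μ := μ) hfm
  have hL1 : LipschitzWith K fun x => f x - m := by simpa using hf.sub (LipschitzWith.const m)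
  have hL2 : LipschitzWith K fun x => m - f x := by simpa using (LipschitzWith.const m).sub hf
  have hg1 : X.norm (gradMod fun x => f x - m) ≤ X.norm (gradMod f) :=
    X.norm_mono _ _ (measurable_gradMod hL1.continuous) (measurable_gradMod hf.continuous)
      (ae_of_all _ (gradMod_mono fun x y => by simp))
  have hg2 : X.norm (gradMod fun x => m - f x) ≤ X.norm (gradMod f) :=
    X.norm_mono _ _ (measurable_gradMod hL2.continuous) (measurable_gradMod hf.continuous)
      (ae_of_all _ (gradMod_mono fun x y => by
        rw [sub_sub_sub_cancel_left, abs_sub_comm]))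
  have hgfin : X.norm (gradMod f) < ∞ := by
    refine (X.norm_mono _ _ (measurable_gradMod hf.continuous) measurable_const
      (ae_of_all _ (gradMod_le hf))).trans_lt ?_
    rw [X.norm_const]
    exact ENNReal.mul_lt_top ENNReal.coe_lt_top X.norm_one_lt_top
  have hm1' : μ {x | 0 < f x - m} ≤ 1 / 2 := by simpa only [sub_pos] using hm1
  have hm2' : μ {x | 0 < m - f x} ≤ 1 / 2 := by simpa only [sub_pos] using hm2
  set N := Y.norm fun x => ‖f x - m‖ₑ with hN
  have hNm : Measurable fun x => ‖f x - m‖ₑ := (hfm.sub_const m).enorm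
  have hN1 : N ≤ 2 * C * X.norm (gradMod f) := by
    calc N ≤ Y.norm (fun x => ENNReal.ofReal (f x - m) + ENNReal.ofReal (m - f x)) := by
          refine Y.norm_mono _ _ hNm ((hfm.sub_const m).ennreal_ofReal.add
            (hfm.const_sub m).ennreal_ofReal) (ae_of_all _ fun x => ?_)
          simp only [Real.enorm_eq_ofReal_abs]
          rcases le_total m (f x) with h | h
          · rw [abs_of_nonneg (sub_nonneg.2 h)]
            exact le_self_add
          · rw [abs_of_nonpos (sub_nonpos.2 h), neg_sub]
            exact le_add_self
      _ ≤ _ := Y.norm_add_le _ _ (hfm.sub_const m).ennreal_ofReal (hfm.const_sub m).ennreal_ofReal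
      _ ≤ C * X.norm (gradMod f) + C * X.norm (gradMod f) := by
          refine add_le_add ((hC _ K hL1 hm1').trans ?_) ((hC _ K hL2 hm2').trans ?_) <;> gcongr
      _ = _ := by ring
  have hNfin : N < ∞ := hN1.trans_lt (ENNReal.mul_lt_top (by simp [ENNReal.mul_lt_top]) hgfin)
  have hint : ∫⁻ x, ‖f x - m‖ₑ ∂μ ≤ D * N := hD _ hNm
  -- Integrability has to be proved, because the Bochner integral of a nonintegrable function is
  -- zero by default; it follows from the finite norm of `f - m` in `Y`.
  have hfi : Integrable (fun x => f x - m) μ :=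
    ⟨(hfm.sub_const m).aestronglyMeasurable,
      hint.trans_lt (ENNReal.mul_lt_top ENNReal.coe_lt_top hNfin)⟩
  have hfi' : Integrable f μ := by
    simpa [Pi.add_def] using hfi.add (integrable_const m)
  have hmean : ‖m - ∫ y, f y ∂μ‖ₑ ≤ D * N := by
    have : ∫ y, (f y - m) ∂μ = ∫ y, f y ∂μ - m := by
      rw [integral_sub hfi' (integrable_const m)]
      simp
    rw [← enorm_neg, neg_sub, ← this]
    exact (enorm_integral_le_lintegral_enorm _).trans hint
  calc Y.norm (fun x => ‖f x - ∫ y, f y ∂μ‖ₑ)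
      ≤ Y.norm (fun x => ‖f x - m‖ₑ + ‖m - ∫ y, f y ∂μ‖₊) := by
        refine Y.norm_mono _ _ (hfm.sub_const _).enorm (hNm.add_const _) (ae_of_all _ fun x => ?_)
        rw [← enorm_eq_nnnorm]
        simpa using enorm_add_le (f x - m) (m - ∫ y, f y ∂μ)
    _ ≤ N + Y.norm (fun _ => (‖m - ∫ y, f y ∂μ‖₊ : ℝ≥0∞)) :=
        Y.norm_add_le _ _ hNm measurable_const
    _ = N + ‖m - ∫ y, f y ∂μ‖ₑ * Y.norm (fun _ => 1) := by rw [Y.norm_const, enorm_eq_nnnorm]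
    _ ≤ N + D * N * Y.norm (fun _ => 1) := by gcongr
    _ = (1 + D * Y.norm (fun _ => 1)) * N := by ring
    _ ≤ (1 + D * Y.norm (fun _ => 1)) * (2 * C * X.norm (gradMod f)) := by gcongr
    _ = _ := by
        push_cast
        rw [ENNReal.coe_toNNReal hY1]
        ring

end HardyToPoincare

/-! ### The Hardy inequality and the two embeddings -/

section Embeddings

/-- On `(t/2, t)` the integrand is at least `k t / t`, and the interval has length `t/2`. -/
lemma le_two_mul_lintegral_div {k : ℝ → ℝ≥0∞} (hk : Antitone k) {t : ℝ} (ht : 0 < t) :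
    k t ≤ 2 * ∫⁻ s in Ioo (t / 2) t, k s / ENNReal.ofReal s := by
  have h1 : ∫⁻ _ in Ioo (t / 2) t, k t / ENNReal.ofReal t ≤
      ∫⁻ s in Ioo (t / 2) t, k s / ENNReal.ofReal s :=
    setLIntegral_mono' measurableSet_Ioo fun s hs =>
      ENNReal.div_le_div (hk hs.2.le) (ENNReal.ofReal_le_ofReal hs.2.le)
  refine le_trans ?_ (mul_le_mul_right h1 2)
  rw [lintegral_const, Measure.restrict_apply_univ, Real.volume_Ioo]
  have h2 : ENNReal.ofReal t = 2 * ENNReal.ofReal (t - t / 2) := by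
    rw [← ENNReal.ofReal_ofNat, ← ENNReal.ofReal_mul (by norm_num)]
    congr 1
    ring
  rw [mul_left_comm, ← h2, ENNReal.div_mul_cancel (by simpa using ht) ENNReal.ofReal_ne_top]

lemma lintegral_Ioo_half (f : ℝ → ℝ≥0∞) (a b : ℝ) :
    ∫⁻ s in Ioo a b, f (s / 2) = 2 * ∫⁻ r in Ioo (a / 2) (b / 2), f r := by
  have he : MeasurableEmbedding fun s : ℝ => (1 / 2) * s :=
    (Homeomorph.mulLeft₀ (1 / 2 : ℝ) (by norm_num)).measurableEmbedding
  have hmap : Measure.map (fun s : ℝ => (1 / 2) * s) volume = (2 : ℝ≥0∞) • volume := by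
    rw [Real.map_volume_mul_left (by norm_num)]
    simp
  have hpre : (fun s : ℝ => (1 / 2) * s) ⁻¹' Ioo (a / 2) (b / 2) = Ioo a b := by
    ext s
    simp only [mem_preimage, mem_Ioo]
    constructor <;> rintro ⟨h1, h2⟩ <;> constructor <;> linarith
  have h := he.lintegral_map (μ := volume.restrict (Ioo a b)) f
  rw [← hpre, ← he.restrict_map, hmap, Measure.restrict_smul, lintegral_smul_measure, hpre] at h
  rw [smul_eq_mul] at h
  rw [h]
  simp only [one_div_mul_eq_div]

lemma rearr_hardyOp_le (I f : ℝ → ℝ≥0∞) (t : ℝ) :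
    rearr unitMeasure (hardyOp I f) t ≤ hardyOp I f t := by
  rw [rearr_le_iff, unitMeasure_apply]
  have : {x | hardyOp I f t < hardyOp I f x} ∩ Ioo 0 1 ⊆ Ioo 0 t := by
    rintro x ⟨hx, hx0, -⟩
    refine ⟨hx0, ?_⟩
    by_contra! hc
    exact absurd (hardyOp_antitone I f hc) (not_le.2 hx)
  refine (measure_mono this).trans ?_
  simp

/-- A Hardy transform is decreasing and, by monotone convergence over `(u n, 1)`, right-continuous,
so on `(0,1)` it is its own rearrangement. -/
lemma le_rearr_hardyOp (I f : ℝ → ℝ≥0∞) {t : ℝ} (ht : t ∈ Ioo (0 : ℝ) 1) :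
    hardyOp I f t ≤ rearr unitMeasure (hardyOp I f) t := by
  refine le_of_forall_lt fun τ hτ => ?_
  rw [lt_rearr_iff]
  obtain ⟨u, hu, hu', hlim⟩ := exists_seq_strictAnti_tendsto' ht.2
  have hun : ⋃ n, Ioo (u n) 1 = Ioo t 1 := by
    ext x
    simp only [mem_iUnion, mem_Ioo, exists_and_right]
    constructor
    · rintro ⟨⟨n, hn⟩, hx⟩
      exact ⟨(hu' n).1.trans hn, hx⟩
    · rintro ⟨h1, h2⟩
      exact ⟨((tendsto_order.1 hlim).2 _ h1).exists, h2⟩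
  have hsup : hardyOp I f t = ⨆ n, hardyOp I f (u n) := by
    simp only [hardyOp, ← hun]
    exact setLIntegral_iUnion_of_directed _ (Monotone.directed_le fun i j hij =>
      Ioo_subset_Ioo_left (hu.antitone hij))
  rw [hsup, lt_iSup_iff] at hτ
  obtain ⟨n, hn⟩ := hτ
  have h1 : Ioc 0 (u n) ⊆ {x | τ < hardyOp I f x} ∩ Ioo 0 1 := fun x hx =>
    ⟨hn.trans_le (hardyOp_antitone I f hx.2), hx.1, hx.2.trans_lt (hu' n).2⟩
  rw [unitMeasure_apply]
  refine lt_of_lt_of_le ?_ (measure_mono h1)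
  rw [Real.volume_Ioc, sub_zero]
  exact (ENNReal.ofReal_lt_ofReal_iff (ht.1.trans (hu' n).1)).2 (hu' n).1

/-- Split `(s, 1)` at `t` and apply Tonelli: each `r < t` is counted for `s` in `(0, r)`, which
produces the weight `r`. -/
lemma lintegral_hardyOp_le {I f : ℝ → ℝ≥0∞} (hI : Measurable I) (hf : Measurable f) (t : ℝ) :
    ∫⁻ s in Ioo 0 t, hardyOp I f s ≤ ENNReal.ofReal t * hardyOp I f t +
      ∫⁻ r in Ioo 0 t, ENNReal.ofReal r * (f r / I r) := by
  have hq : Measurable fun r => f r / I r := hf.div hI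
  have h1 : ∀ s ∈ Ioo 0 t, hardyOp I f s ≤
      hardyOp I f t + ∫⁻ r in Ioo 0 t, (Ioi s).indicator (fun r => f r / I r) r := by
    intro s hs
    rw [setLIntegral_indicator measurableSet_Ioi, add_comm]
    have hsub : Ioo s 1 ⊆ (Ioi s ∩ Ioo 0 t) ∪ Ico t 1 := by
      rintro r ⟨hr1, hr2⟩
      rcases lt_or_ge r t with h | h
      · exact Or.inl ⟨hr1, hs.1.trans hr1, h⟩
      · exact Or.inr ⟨h, hr2⟩
    refine (lintegral_mono_set hsub).trans ((lintegral_union_le _ _ _).trans ?_)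
    rw [setLIntegral_congr Ioo_ae_eq_Ico.symm]
    exact le_rfl
  have hjm : Measurable (Function.uncurry fun s r : ℝ =>
      (Ioi s).indicator (fun r => f r / I r) r) := by
    have : (Function.uncurry fun s r : ℝ => (Ioi s).indicator (fun r => f r / I r) r) =
        {p : ℝ × ℝ | p.1 < p.2}.indicator fun p => f p.2 / I p.2 := by
      ext ⟨s, r⟩
      simp [indicator]
    rw [this]
    exact (hq.comp measurable_snd).indicator (measurableSet_lt measurable_fst measurable_snd)
  calc ∫⁻ s in Ioo 0 t, hardyOp I f s
      ≤ ∫⁻ s in Ioo 0 t, (hardyOp I f t +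
          ∫⁻ r in Ioo 0 t, (Ioi s).indicator (fun r => f r / I r) r) :=
        setLIntegral_mono' measurableSet_Ioo h1
    _ = ENNReal.ofReal t * hardyOp I f t +
          ∫⁻ s in Ioo 0 t, ∫⁻ r in Ioo 0 t, (Ioi s).indicator (fun r => f r / I r) r := by
        rw [lintegral_add_left measurable_const, lintegral_const, Measure.restrict_apply_univ,
          Real.volume_Ioo, sub_zero, mul_comm]
    _ = ENNReal.ofReal t * hardyOp I f t +
          ∫⁻ r in Ioo 0 t, ∫⁻ s in Ioo 0 t, (Ioi s).indicator (fun r => f r / I r) r := by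
        rw [lintegral_lintegral_swap hjm.aemeasurable]
    _ ≤ _ := by
        gcongr with r hr
        have : ∀ s, (Ioi s).indicator (fun r => f r / I r) r =
            (Iio r).indicator (fun _ => f r / I r) s := fun s => by
          simp [indicator]
        simp only [this]
        rw [setLIntegral_indicator measurableSet_Iio, setLIntegral_const, mul_comm]
        gcongr
        have hsub : Iio r ∩ Ioo 0 t ⊆ Ioo 0 r := fun s hs => ⟨hs.2.1, hs.1⟩
        exact (measure_mono hsub).trans (by simp)

variable {Ω : Type*} [MeasurableSpace Ω] {μ : Measure Ω}
  {I : ℝ → ℝ≥0∞} {U : Ω → ℝ} {X Y : RINorm μ}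

theorem hardyBounded_of_weightedEmbedding (hI : ProfileBounds I)
    (hU : MeasurePreserving U μ unitMeasure) (hQ : QBounded I X)
    (hW : WeightedEmbedding I X Y) : HardyBounded I X Y := by
  obtain ⟨C₁, hC₁⟩ := hQ
  obtain ⟨C₂, hC₂⟩ := hW
  refine ⟨C₂ * C₁, fun f hf hfin hfs => ?_⟩
  have hq : Measurable fun t : ℝ => I t / ENNReal.ofReal t :=
    hI.measurable.div ENNReal.measurable_ofReal
  refine (hC₂ _ (measurable_hardyOp I f)).trans ?_
  rw [ENNReal.coe_mul, mul_assoc]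
  gcongr
  refine le_trans ?_ (hC₁ f hf hfin hfs)
  refine X.bar_mono hU ((measurable_rearr _ _).mul hq) (hq.mul (measurable_hardyOp I f))
    fun t ht => ?_
  rw [opQ, mul_comm]
  gcongr
  exact rearr_hardyOp_le I f t

variable [IsProbabilityMeasure μ]

/-- With `W = f* I/t` the quotient `W/I` is `f*(s)/s`, whose integral over `(t/4, t/2)` already
bounds `f*(t)`. Working below `t/2` keeps the integration inside `(0,1/2)`, where the Hardy bound
applies. -/
theorem weightedEmbedding_of_hardyBounded (hI : ProfileBounds I)
    (hU : MeasurePreserving U μ unitMeasure) (hH : HardyBounded I X Y) :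
    WeightedEmbedding I X Y := by
  obtain ⟨C, hC⟩ := hH
  -- The 8 is a pointwise factor 2 and two dilations; the added 1 keeps the constant nonzero, so the
  -- case of an infinite right side is trivial.
  refine ⟨8 * C + 1, fun f hf => ?_⟩
  set W : ℝ → ℝ≥0∞ := fun t => rearr unitMeasure f t * (I t / ENNReal.ofReal t) with hW
  have hWm : Measurable W :=
    (measurable_rearr _ _).mul (hI.measurable.div ENNReal.measurable_ofReal)
  rcases eq_or_ne (X.bar W) ∞ with htop | htop
  · rw [htop, ENNReal.mul_top (by simp)]
    exact le_top
  set g := (Ioo (0 : ℝ) (1 / 2)).indicator W with hg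
  have hgm : Measurable g := hWm.indicator measurableSet_Ioo
  have hgW : X.bar g ≤ X.bar W := X.bar_mono hU hgm hWm fun t _ => indicator_le_self _ _ _
  have hgs : Function.support g ⊆ Ioo 0 (1 / 2) := support_indicator_subset
  have hle : ∀ t ∈ Ioo (0 : ℝ) 1, rearr unitMeasure f t ≤ 2 * hardyOp I g (t / 2 / 2) := by
    intro t ht
    have h0 : 0 < t / 2 := by linarith [ht.1]
    refine (rearr_antitone _ _ (by linarith [ht.1] : t / 2 ≤ t)).trans ?_
    refine (le_two_mul_lintegral_div (rearr_antitone unitMeasure f) h0).trans ?_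
    gcongr
    rw [hardyOp]
    refine le_trans ?_ (lintegral_mono_set (Ioo_subset_Ioo_right (by linarith [ht.2] : t / 2 ≤ 1)))
    refine setLIntegral_mono' measurableSet_Ioo fun s hs => ?_
    have hs1 : s ∈ Ioo (0 : ℝ) (1 / 2) := ⟨by linarith [hs.1], by linarith [hs.2, ht.2]⟩
    have hs2 : s ∈ Ioo (0 : ℝ) 1 := ⟨hs1.1, by linarith [hs1.2]⟩
    rw [hg, indicator_of_mem hs1, hW]
    simp only [div_eq_mul_inv]
    rw [mul_assoc, mul_right_comm (I s), ENNReal.mul_inv_cancel (hI.pos s hs2) (hI.ne_top s hs2),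
      one_mul]
  have hGm := measurable_hardyOp I g
  have hG2 : Measurable fun t => hardyOp I g (t / 2) := hGm.comp (measurable_id.div_const 2)
  have hG4 : Measurable fun t => hardyOp I g (t / 2 / 2) := hG2.comp (measurable_id.div_const 2)
  calc Y.bar f = Y.bar (rearr unitMeasure f) := (Y.bar_rearr_unit hU hf).symm
    _ ≤ Y.bar (fun t => (2 : ℝ≥0) * hardyOp I g (t / 2 / 2)) :=
        Y.bar_mono hU (measurable_rearr _ _) (hG4.const_mul _) hle
    _ = 2 * Y.bar (fun t => hardyOp I g (t / 2 / 2)) := by rw [Y.bar_smul hU hG4]; simp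
    _ ≤ 2 * (2 * (2 * Y.bar (hardyOp I g))) := by
        gcongr
        refine (Y.bar_dilate hU hG2).trans ?_
        gcongr
        exact Y.bar_dilate hU hGm
    _ ≤ 2 * (2 * (2 * (C * X.bar W))) := by
        gcongr
        exact (hC g hgm (hgW.trans_lt (lt_top_iff_ne_top.2 htop)) hgs).trans (by gcongr)
    _ = (8 * C : ℝ≥0) * X.bar W := by
        push_cast
        ring
    _ ≤ _ := by
        gcongr
        exact le_self_add

/-- The mean of `f*` over `(0, s)` is at least the average of `f*(s/2)` and `f*(s)`, so the drop of
`f*` from `s/2` to `s` is at most `2 (f** - f*)(s)`. -/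
lemma rearr_half_le {f : ℝ → ℝ≥0∞} {s : ℝ} (hs : 0 < s) (hfin : rearr unitMeasure f s ≠ ∞) :
    rearr unitMeasure f (s / 2) ≤ rearr unitMeasure f s +
      2 * (maxRearr unitMeasure f s - rearr unitMeasure f s) := by
  set k := rearr unitMeasure f with hk
  have hka : Antitone k := rearr_antitone _ _
  have hs0 : ENNReal.ofReal s ≠ 0 := by simpa using hs
  have h2 : ENNReal.ofReal s = 2 * ENNReal.ofReal (s / 2) := by
    rw [← ENNReal.ofReal_ofNat, ← ENNReal.ofReal_mul (by norm_num)]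
    congr 1
    ring
  have h1 : k (s / 2) + k s ≤ 2 * maxRearr unitMeasure f s := by
    have h3 : k (s / 2) * ENNReal.ofReal (s / 2) + k s * ENNReal.ofReal (s / 2) ≤
        ∫⁻ r in Ioo 0 s, k r := by
      have e1 : k (s / 2) * ENNReal.ofReal (s / 2) = ∫⁻ _ in Ioo 0 (s / 2), k (s / 2) := by simp
      have e2 : k s * ENNReal.ofReal (s / 2) = ∫⁻ _ in Ioo (s / 2) s, k s := by
        rw [setLIntegral_const, Real.volume_Ioo, sub_half]
      have hd : Disjoint (Ioo 0 (s / 2)) (Ioo (s / 2) s) := by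
        rw [Set.disjoint_left]
        exact fun t ht ht' => lt_asymm ht.2 ht'.1
      have hsub : Ioo 0 (s / 2) ∪ Ioo (s / 2) s ⊆ Ioo 0 s :=
        union_subset (Ioo_subset_Ioo_right (by linarith)) (Ioo_subset_Ioo_left (by linarith))
      rw [e1, e2]
      refine le_trans (add_le_add ?_ ?_) ((lintegral_union measurableSet_Ioo hd (f := k)).symm.trans_le
        (lintegral_mono_set hsub))
      · exact setLIntegral_mono' measurableSet_Ioo fun r hr => hka hr.2.le
      · exact setLIntegral_mono' measurableSet_Ioo fun r hr => hka hr.2.le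
    calc k (s / 2) + k s
        = 2 * ((k (s / 2) * ENNReal.ofReal (s / 2) + k s * ENNReal.ofReal (s / 2)) /
            ENNReal.ofReal s) := by
          rw [← add_mul, ← mul_div_assoc, mul_left_comm, ← h2,
            ENNReal.mul_div_cancel_right hs0 ENNReal.ofReal_ne_top]
      _ ≤ _ := by
          rw [maxRearr]
          gcongr
  have h4 : k (s / 2) + k s ≤ k s + 2 * (maxRearr unitMeasure f s - k s) + k s := by
    refine h1.trans ((mul_le_mul_right (le_tsub_add (a := k s)) 2).trans_eq ?_)
    ring
  exact (ENNReal.add_le_add_iff_right hfin).1 h4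

/-- A discrete form of `f**(t) - f**(1/4) = ∫ (f** - f*) ds/s`. -/
lemma rearr_le_lintegral_sub {f : ℝ → ℝ≥0∞} (hfin : ∀ s, 0 < s → rearr unitMeasure f s ≠ ∞)
    {t : ℝ} (ht : 0 < t) :
    rearr unitMeasure f t ≤ 2 * rearr unitMeasure f (1 / 4) +
      4 * ∫⁻ s in Ioo t (1 / 2),
        (maxRearr unitMeasure f s - rearr unitMeasure f s) / ENNReal.ofReal s := by
  set k := rearr unitMeasure f with hk
  have hka : Antitone k := rearr_antitone _ _
  have hkm : Measurable k := hka.measurable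
  set D := fun s => maxRearr unitMeasure f s - k s with hD
  have hDm : Measurable D := (measurable_maxRearr _ _).sub hkm
  rcases le_or_gt (1 / 4) t with h4 | h4
  · refine (hka h4).trans (le_trans ?_ le_self_add)
    exact le_mul_of_one_le_left' (by norm_num)
  set q : ℝ → ℝ≥0∞ := fun s => k s / ENNReal.ofReal s with hq
  have hqm : Measurable q := hkm.div ENNReal.measurable_ofReal
  have hqt : ∀ s, t < s → q s ≤ k t / ENNReal.ofReal t := fun s hs =>
    ENNReal.div_le_div (hka hs.le) (ENNReal.ofReal_le_ofReal hs.le)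
  have hfinI : ∫⁻ s in Ioo t (1 / 4), q s ≠ ∞ := by
    refine ne_top_of_le_ne_top ?_ (setLIntegral_mono' measurableSet_Ioo fun s hs => hqt s hs.1)
    rw [setLIntegral_const, Real.volume_Ioo]
    exact ENNReal.mul_ne_top (ENNReal.div_ne_top (hfin t ht) (by simpa using ht))
      ENNReal.ofReal_ne_top
  have hscale : ∫⁻ s in Ioo t (1 / 2), k (s / 2) / ENNReal.ofReal s =
      ∫⁻ r in Ioo (t / 2) (1 / 4), q r := by
    have e1 : ∀ s, k (s / 2) / ENNReal.ofReal s = (1 / 2) * q (s / 2) := by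
      intro s
      simp only [hq]
      rw [ENNReal.ofReal_div_of_pos (by norm_num)]
      simp only [div_eq_mul_inv, ENNReal.ofReal_ofNat, one_mul]
      rw [ENNReal.mul_inv (by simp) (by simp), inv_inv, mul_left_comm, mul_left_comm (2⁻¹),
        mul_comm (2⁻¹), ENNReal.mul_inv_cancel (by simp) (by simp), mul_one]
    simp only [e1]
    have hq2 : Measurable fun s => q (s / 2) := hqm.comp (measurable_id.div_const 2)
    rw [lintegral_const_mul _ hq2, lintegral_Ioo_half,
      ← mul_assoc, one_div, ENNReal.inv_mul_cancel (by simp) (by simp), one_mul]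
    norm_num
  -- The halving estimate is integrated against `ds/s`, which is invariant under `s ↦ s/2`.
  have hmain : ∫⁻ r in Ioo (t / 2) (1 / 4), q r ≤
      (∫⁻ s in Ioo t (1 / 2), q s) + 2 * ∫⁻ s in Ioo t (1 / 2), D s / ENNReal.ofReal s := by
    have hDs : Measurable fun s => D s / ENNReal.ofReal s := hDm.div ENNReal.measurable_ofReal
    rw [← hscale, ← lintegral_const_mul _ hDs,
      ← lintegral_add_left hqm]
    refine setLIntegral_mono' measurableSet_Ioo fun s hs => ?_
    have hs0 : 0 < s := ht.trans hs.1
    simp only [hq]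
    rw [← mul_div_assoc, ← ENNReal.add_div]
    gcongr
    exact rearr_half_le hs0 (hfin s hs0)
  have hleft : (∫⁻ r in Ioo (t / 2) t, q r) + ∫⁻ r in Ioo t (1 / 4), q r ≤
      ∫⁻ r in Ioo (t / 2) (1 / 4), q r := by
    rw [← lintegral_union measurableSet_Ioo]
    · exact lintegral_mono_set (union_subset (Ioo_subset_Ioo_right h4.le)
        (Ioo_subset_Ioo_left (by linarith)))
    · rw [Set.disjoint_left]
      exact fun x hx hx' => lt_asymm hx.2 hx'.1
  have hright : ∫⁻ r in Ioo t (1 / 2), q r ≤ k (1 / 4) + ∫⁻ r in Ioo t (1 / 4), q r := by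
    have hsub : Ioo t (1 / 2) ⊆ Ico (1 / 4) (1 / 2) ∪ Ioo t (1 / 4) := by
      rintro r ⟨hr1, hr2⟩
      rcases lt_or_ge r (1 / 4) with h | h
      · exact Or.inr ⟨hr1, h⟩
      · exact Or.inl ⟨h, hr2⟩
    refine (lintegral_mono_set hsub).trans ((lintegral_union_le _ _ _).trans ?_)
    gcongr
    calc ∫⁻ r in Ico (1 / 4) (1 / 2), q r
        ≤ ∫⁻ _ in Ico (1 / 4 : ℝ) (1 / 2), k (1 / 4) / ENNReal.ofReal (1 / 4) :=
          setLIntegral_mono' measurableSet_Ico fun r hr =>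
            ENNReal.div_le_div (hka hr.1) (ENNReal.ofReal_le_ofReal hr.1)
      _ = k (1 / 4) := by
          rw [setLIntegral_const, Real.volume_Ico, show (1 / 2 - 1 / 4 : ℝ) = 1 / 4 by norm_num]
          exact ENNReal.div_mul_cancel (by simp) ENNReal.ofReal_ne_top
  -- Both sides contain the finite integral of `q` over `(t, 1/4)`; cancelling it leaves the pieces
  -- at the two ends.
  have hcancel : ∫⁻ r in Ioo (t / 2) t, q r ≤
      k (1 / 4) + 2 * ∫⁻ s in Ioo t (1 / 2), D s / ENNReal.ofReal s := by
    refine (ENNReal.add_le_add_iff_right hfinI).1 (hleft.trans (hmain.trans ?_))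
    rw [add_right_comm]
    gcongr
  calc k t ≤ 2 * ∫⁻ s in Ioo (t / 2) t, q s := le_two_mul_lintegral_div hka ht
    _ ≤ 2 * (k (1 / 4) + 2 * ∫⁻ s in Ioo t (1 / 2), D s / ENNReal.ofReal s) := by gcongr
    _ = _ := by ring

theorem lsEmbedding_of_hardyBounded (hI : ProfileBounds I)
    (hU : MeasurePreserving U μ unitMeasure) (hH : HardyBounded I X Y) : LSEmbedding I X Y := by
  obtain ⟨C, hC⟩ := hH
  have hY1 : Y.norm (fun _ => 1) ≠ ∞ := Y.norm_one_lt_top.ne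
  -- The 8 combines `2 f*(1/4)` with `f*(1/4) ≤ 4 ‖f‖_{L¹}`; the 4 is the coefficient of the Hardy
  -- transform.
  refine ⟨4 * C + 8 * (Y.norm fun _ => 1).toNNReal + 1, fun f hf => ?_⟩
  rw [normLS]
  set k := rearr unitMeasure f with hk
  have hka : Antitone k := rearr_antitone _ _
  have hkm : Measurable k := hka.measurable
  set W : ℝ → ℝ≥0∞ := fun t => (maxRearr unitMeasure f t - k t) * (I t / ENNReal.ofReal t) with hW
  have hWm : Measurable W :=
    ((measurable_maxRearr _ _).sub hkm).mul (hI.measurable.div ENNReal.measurable_ofReal)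
  set L := ∫⁻ t, f t ∂unitMeasure with hL
  rcases eq_or_ne (X.bar W + L) ∞ with htop | htop
  · rw [htop, ENNReal.mul_top (by simp)]
    exact le_top
  obtain ⟨hWtop, hLtop⟩ := ENNReal.add_ne_top.1 htop
  set g := (Ioo (0 : ℝ) (1 / 2)).indicator W with hg
  have hgm : Measurable g := hWm.indicator measurableSet_Ioo
  have hgW : X.bar g ≤ X.bar W := X.bar_mono hU hgm hWm fun t _ => indicator_le_self _ _ _
  have hgs : Function.support g ⊆ Ioo 0 (1 / 2) := support_indicator_subset
  have hweak : ∀ s, 0 < s → s ≤ 1 → k s * ENNReal.ofReal s ≤ L := by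
    intro s hs hs1
    calc k s * ENNReal.ofReal s = ∫⁻ _ in Ioo 0 s, k s := by simp
      _ ≤ ∫⁻ r in Ioo 0 s, k r :=
          setLIntegral_mono' measurableSet_Ioo fun r hr => hka hr.2.le
      _ ≤ ∫⁻ r in Ioo 0 1, k r := lintegral_mono_set (Ioo_subset_Ioo_right hs1)
      _ = L := lintegral_rearr hf
  have hkfin1 : ∀ s, 0 < s → s ≤ 1 → k s ≠ ∞ := by
    intro s hs hs1 h
    have := hweak s hs hs1
    rw [h, ENNReal.top_mul (by simpa using hs)] at this
    exact hLtop (top_le_iff.1 this)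
  have hkfin : ∀ s, 0 < s → k s ≠ ∞ := fun s hs =>
    ne_top_of_le_ne_top (hkfin1 (min s 1) (lt_min hs one_pos) (min_le_right _ _))
      (hka (min_le_left _ _))
  have hk4 : k (1 / 4) ≤ 4 * L := by
    have h := hweak (1 / 4) (by norm_num) (by norm_num)
    rw [ENNReal.ofReal_div_of_pos (by norm_num), ENNReal.ofReal_one, ENNReal.ofReal_ofNat,
      mul_one_div] at h
    rw [mul_comm]
    exact (ENNReal.div_le_iff (by simp) (by simp)).1 h
  have hle : ∀ t ∈ Ioo (0 : ℝ) 1, k t ≤ 8 * L + 4 * hardyOp I g t := by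
    intro t ht
    refine (rearr_le_lintegral_sub hkfin ht.1).trans ?_
    refine add_le_add ((mul_le_mul_right hk4 2).trans_eq (by ring)) ?_
    gcongr
    rw [hardyOp]
    refine le_trans ?_ (lintegral_mono_set (Ioo_subset_Ioo_right (by norm_num : (1 / 2 : ℝ) ≤ 1)))
    refine setLIntegral_mono' measurableSet_Ioo fun s hs => ?_
    have hs1 : s ∈ Ioo (0 : ℝ) (1 / 2) := ⟨ht.1.trans hs.1, hs.2⟩
    have hs2 : s ∈ Ioo (0 : ℝ) 1 := ⟨hs1.1, by linarith [hs1.2]⟩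
    rw [hg, indicator_of_mem hs1, hW]
    simp only [div_eq_mul_inv]
    rw [mul_assoc, mul_right_comm (I s), ENNReal.mul_inv_cancel (hI.pos s hs2) (hI.ne_top s hs2),
      one_mul]
  have hGm := measurable_hardyOp I g
  calc Y.bar f = Y.bar k := (Y.bar_rearr_unit hU hf).symm
    _ ≤ Y.bar (fun t => 8 * L + (4 : ℝ≥0) * hardyOp I g t) :=
        Y.bar_mono hU hkm ((hGm.const_mul _).const_add _) hle
    _ ≤ Y.bar (fun _ => 8 * L) + Y.bar (fun t => (4 : ℝ≥0) * hardyOp I g t) :=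
        Y.bar_add_le hU measurable_const (hGm.const_mul _)
    _ = 8 * L * Y.norm (fun _ => 1) + 4 * Y.bar (hardyOp I g) := by
        rw [Y.bar_smul hU hGm, Y.bar_eq hU measurable_const]
        have : (8 * L : ℝ≥0∞) = ((8 * L).toNNReal : ℝ≥0∞) :=
          (ENNReal.coe_toNNReal (ENNReal.mul_ne_top (by simp) hLtop)).symm
        rw [this]
        congr 1
        exact Y.norm_const _
    _ ≤ 8 * L * Y.norm (fun _ => 1) + 4 * (C * X.bar W) := by
        gcongr
        exact (hC g hgm (hgW.trans_lt (lt_top_iff_ne_top.2 hWtop)) hgs).trans (by gcongr)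
    _ ≤ 8 * L * Y.norm (fun _ => 1) + 4 * (C * X.bar W) +
          (4 * C * L + 8 * Y.norm (fun _ => 1) * X.bar W + (X.bar W + L)) := le_self_add
    _ = _ := by
        push_cast
        rw [ENNReal.coe_toNNReal hY1]
        ring

/-- For a Hardy transform `F`, Tonelli gives `(F** - F*)(t) ≤ (1/t) ∫_0^t r f(r)/I(r) dr`. Since
`I(t)/t ≤ I(r)/r` for `r ≤ t`, the weight turns this into at most `f**(t)`, whose norm is controlled
by hypothesis. -/
theorem hardyBounded_of_lsEmbedding (hI : ProfileBounds I)
    (hU : MeasurePreserving U μ unitMeasure) (hM : MaximalNormEquiv X)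
    (hL : LSEmbedding I X Y) : HardyBounded I X Y := by
  obtain ⟨C₁, hC₁⟩ := hM
  obtain ⟨C₂, hC₂⟩ := hL
  obtain ⟨C₃, hC₃⟩ := X.exists_lintegral_le_bar hU
  have hhalf : (1 / 2 : ℝ) ∈ Ioo (0 : ℝ) 1 := by norm_num
  -- The quotient `r / I r` increases, so this is its bound on the support of `f`.
  set c : ℝ≥0 := (ENNReal.ofReal (1 / 2) / I (1 / 2)).toNNReal with hc
  have hcc : (c : ℝ≥0∞) = ENNReal.ofReal (1 / 2) / I (1 / 2) :=
    ENNReal.coe_toNNReal (ENNReal.div_ne_top ENNReal.ofReal_ne_top (hI.pos _ hhalf))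
  refine ⟨C₂ * (C₁ + c * C₃), fun f hf hfin hfs => ?_⟩
  set F := hardyOp I f with hF
  have hFm : Measurable F := measurable_hardyOp I f
  have hL1 : ∫⁻ t, F t ∂unitMeasure ≤ c * (C₃ * X.bar f) := by
    have h1 := lintegral_hardyOp_le hI.measurable hf 1
    have h0 : hardyOp I f 1 = 0 := by simp [hardyOp]
    rw [h0, mul_zero, zero_add] at h1
    refine h1.trans (le_trans ?_ (mul_le_mul_right (hC₃ f hf) _))
    rw [← lintegral_const_mul _ hf, unitMeasure]
    refine setLIntegral_mono' measurableSet_Ioo fun r hr => ?_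
    by_cases hfr : f r = 0
    · simp [hfr]
    have hr2 : r < 1 / 2 := (hfs hfr).2
    have h2 := hI.ratio r (1 / 2) hr.1 hr2.le (by norm_num)
    have h3 : ENNReal.ofReal r / I r ≤ c := by
      rw [hcc, ENNReal.div_le_iff (hI.pos r hr) (hI.ne_top r hr), mul_comm, ← mul_div_assoc,
        ENNReal.le_div_iff_mul_le (Or.inl (hI.pos _ hhalf)) (Or.inl (hI.ne_top _ hhalf)), mul_comm]
      exact h2
    calc ENNReal.ofReal r * (f r / I r) = ENNReal.ofReal r / I r * f r := by
          simp only [div_eq_mul_inv]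
          ring
      _ ≤ c * f r := by gcongr
  have hD : ∀ t ∈ Ioo (0 : ℝ) 1, (maxRearr unitMeasure F t - rearr unitMeasure F t) *
      (I t / ENNReal.ofReal t) ≤ maxRearr unitMeasure f t := by
    intro t ht
    have ht0 : ENNReal.ofReal t ≠ 0 := by simpa using ht.1
    have h1 : maxRearr unitMeasure F t - rearr unitMeasure F t ≤
        (∫⁻ r in Ioo 0 t, ENNReal.ofReal r * (f r / I r)) / ENNReal.ofReal t := by
      rw [tsub_le_iff_right, maxRearr]
      have h2 : ∫⁻ s in Ioo 0 t, rearr unitMeasure F s ≤ ∫⁻ s in Ioo 0 t, F s :=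
        setLIntegral_mono' measurableSet_Ioo fun s hs => rearr_hardyOp_le I f s
      refine (ENNReal.div_le_div_right
        (h2.trans (lintegral_hardyOp_le hI.measurable hf t)) _).trans ?_
      rw [add_comm, ENNReal.add_div, mul_comm (ENNReal.ofReal t),
        ENNReal.mul_div_cancel_right ht0 ENNReal.ofReal_ne_top]
      gcongr
      exact le_rearr_hardyOp I f ht
    have hqm : Measurable fun r => ENNReal.ofReal r * (f r / I r) :=
      ENNReal.measurable_ofReal.mul (hf.div hI.measurable)
    calc (maxRearr unitMeasure F t - rearr unitMeasure F t) * (I t / ENNReal.ofReal t)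
        ≤ (∫⁻ r in Ioo 0 t, ENNReal.ofReal r * (f r / I r)) / ENNReal.ofReal t *
            (I t / ENNReal.ofReal t) := by gcongr
      _ = (∫⁻ r in Ioo 0 t, ENNReal.ofReal r * (f r / I r) * (I t / ENNReal.ofReal t)) /
            ENNReal.ofReal t := by
          rw [lintegral_mul_const _ hqm]
          simp only [div_eq_mul_inv]
          ring
      _ ≤ (∫⁻ r in Ioo 0 t, f r) / ENNReal.ofReal t := by
          gcongr ?_ / _
          refine setLIntegral_mono' measurableSet_Ioo fun r hr => ?_
          have hr1 : r ∈ Ioo (0 : ℝ) 1 := ⟨hr.1, hr.2.trans ht.2⟩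
          have h3 := hI.ratio r t hr.1 hr.2.le ht.2
          have hr0 : ENNReal.ofReal r ≠ 0 := by simpa using hr.1
          calc ENNReal.ofReal r * (f r / I r) * (I t / ENNReal.ofReal t)
              = f r * ((I t * ENNReal.ofReal r) / (I r * ENNReal.ofReal t)) := by
                simp only [div_eq_mul_inv]
                rw [ENNReal.mul_inv (Or.inl (hI.pos r hr1)) (Or.inl (hI.ne_top r hr1))]
                ring
            _ ≤ f r * 1 := by
                gcongr
                exact ENNReal.div_le_of_le_mul (by rwa [one_mul])
            _ = f r := mul_one _
      _ ≤ _ := by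
          rw [maxRearr]
          gcongr ?_ / _
          exact lintegral_Ioo_le_lintegral_rearr hf ht.2.le
  have hmax : X.bar (maxRearr unitMeasure f) ≤ C₁ * X.bar f := by
    have h := (hC₁ (f ∘ U) (hf.comp hU.measurable)).2
    have e : maxRearr μ (f ∘ U) = maxRearr unitMeasure f := by
      funext t
      rw [maxRearr, maxRearr, rearr_comp hU hf]
    rwa [e, ← X.bar_eq hU hf] at h
  have hWm : Measurable fun t => (maxRearr unitMeasure F t - rearr unitMeasure F t) *
      (I t / ENNReal.ofReal t) :=
    ((measurable_maxRearr _ _).sub (measurable_rearr _ _)).mul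
      (hI.measurable.div ENNReal.measurable_ofReal)
  calc Y.bar F ≤ C₂ * (normLS I X F + ∫⁻ t, F t ∂unitMeasure) := hC₂ F hFm
    _ ≤ C₂ * (C₁ * X.bar f + c * (C₃ * X.bar f)) := by
        gcongr
        exact (X.bar_mono hU hWm (measurable_maxRearr _ _) hD).trans hmax
    _ = _ := by
        push_cast
        ring

end Embeddings

/-! ### The distribution function as a measure-preserving map -/

section LineMeasure

variable {φ : ℝ → ℝ}

lemma isProbabilityMeasure_lineMeasure (hφ1 : ∫⁻ x, ENNReal.ofReal (φ x) = 1) :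
    IsProbabilityMeasure (lineMeasure φ) := by
  rw [lineMeasure]
  exact ⟨by rw [withDensity_apply _ MeasurableSet.univ, setLIntegral_univ, hφ1]⟩

lemma lineMeasure_absolutelyContinuous (φ : ℝ → ℝ) : lineMeasure φ ≪ volume :=
  withDensity_absolutelyContinuous _ _

lemma continuous_cdf_lineMeasure [IsProbabilityMeasure (lineMeasure φ)] :
    Continuous (ProbabilityTheory.cdf (lineMeasure φ)) := by
  set F := ProbabilityTheory.cdf (lineMeasure φ) with hF
  rw [continuous_iff_continuousAt]
  intro a
  rw [F.mono.continuousAt_iff_leftLim_eq_rightLim, F.rightLim_eq]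
  refine le_antisymm (F.mono.leftLim_le le_rfl) ?_
  have h := F.measure_singleton a
  rw [hF, ProbabilityTheory.measure_cdf,
    lineMeasure_absolutelyContinuous φ Real.volume_singleton, eq_comm, ENNReal.ofReal_eq_zero] at h
  linarith

/-- The probability integral transform. For `t` in `(0,1)` the set `{F ≤ t}` is a closed half-line,
and by continuity `F` equals `t` at its endpoint, flat pieces notwithstanding. -/
lemma measurePreserving_cdf [IsProbabilityMeasure (lineMeasure φ)] :
    MeasurePreserving (ProbabilityTheory.cdf (lineMeasure φ)) (lineMeasure φ) unitMeasure := by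
  set ν := lineMeasure φ with hν
  set F := ProbabilityTheory.cdf ν with hF
  have hFc : Continuous F := continuous_cdf_lineMeasure
  have hFm : Measurable F := hFc.measurable
  refine ⟨hFm, ?_⟩
  have := Measure.isProbabilityMeasure_map (μ := ν) hFm.aemeasurable
  have hmid : ∀ t ∈ Ioo (0 : ℝ) 1, ν (F ⁻¹' Iic t) = ENNReal.ofReal t := by
    intro t ht
    obtain ⟨x₀, hx₀⟩ := mem_range_of_exists_le_of_exists_ge hFc
      ((ProbabilityTheory.tendsto_cdf_atBot ν).eventually (ge_mem_nhds ht.1)).exists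
      ((ProbabilityTheory.tendsto_cdf_atTop ν).eventually (le_mem_nhds ht.2)).exists
    obtain ⟨b', hb'⟩ := ((ProbabilityTheory.tendsto_cdf_atTop ν).eventually
      (lt_mem_nhds ht.2)).exists
    have hbdd : BddAbove (F ⁻¹' Iic t) := by
      refine ⟨b', fun x (hx : F x ≤ t) => ?_⟩
      by_contra! hlt
      exact absurd ((F.mono hlt.le).trans hx) (not_le.2 hb')
    have hmem : sSup (F ⁻¹' Iic t) ∈ F ⁻¹' Iic t :=
      (isClosed_Iic.preimage hFc).csSup_mem ⟨x₀, hx₀.le⟩ hbdd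
    have hset : F ⁻¹' Iic t = Iic (sSup (F ⁻¹' Iic t)) := by
      ext x
      exact ⟨fun hx => le_csSup hbdd hx, fun hx => (F.mono hx).trans hmem⟩
    have hval : F (sSup (F ⁻¹' Iic t)) = t :=
      le_antisymm hmem (hx₀.symm.trans_le (F.mono (le_csSup hbdd hx₀.le)))
    rw [hset, ← ProbabilityTheory.ofReal_cdf, hval]
  refine Measure.ext_of_Iic _ _ fun t => ?_
  rw [Measure.map_apply hFm measurableSet_Iic, unitMeasure_apply]
  rcases lt_or_ge t 1 with h1 | h1
  · rcases lt_or_ge 0 t with h0 | h0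
    · have hIoc : Iic t ∩ Ioo 0 1 = Ioc 0 t := by
        ext x
        simp only [mem_inter_iff, mem_Iic, mem_Ioo, mem_Ioc]
        exact ⟨fun h => ⟨h.2.1, h.1⟩, fun h => ⟨h.2, h.1, h.2.trans_lt h1⟩⟩
      rw [hmid t ⟨h0, h1⟩, hIoc, Real.volume_Ioc, sub_zero]
    · have hempty : Iic t ∩ Ioo 0 1 = ∅ := by
        ext x
        simp only [mem_inter_iff, mem_Iic, mem_Ioo, mem_empty_iff_false, iff_false]
        exact fun h => absurd (h.2.1.trans_le h.1) (not_lt.2 h0)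
      rw [hempty, measure_empty, ← nonpos_iff_eq_zero]
      have hlim : Tendsto (fun s : ℝ => ENNReal.ofReal s) (𝓝[>] 0) (𝓝 0) := by
        have := (ENNReal.continuous_ofReal.tendsto 0).mono_left (nhdsWithin_le_nhds (s := Ioi 0))
        simpa using this
      refine ge_of_tendsto hlim ?_
      filter_upwards [Ioo_mem_nhdsGT one_pos] with s hs
      rw [← hmid s hs]
      exact measure_mono (preimage_mono (Iic_subset_Iic.2 (h0.trans hs.1.le)))
  · have hpre : F ⁻¹' Iic t = univ :=
      eq_univ_of_forall fun x => (ProbabilityTheory.cdf_le_one ν x).trans h1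
    have hIoo : Iic t ∩ Ioo 0 1 = Ioo 0 1 := inter_eq_right.2 fun x hx => hx.2.le.trans h1
    rw [hpre, hIoo, measure_univ]
    simp

lemma ae_cdf_mem_Ioo [IsProbabilityMeasure (lineMeasure φ)] :
    ∀ᵐ z ∂lineMeasure φ, ProbabilityTheory.cdf (lineMeasure φ) z ∈ Ioo (0 : ℝ) 1 :=
  measurePreserving_cdf.quasiMeasurePreserving.ae (ae_unitMeasure_of_forall fun _ ht => ht)

/-- Almost no point lies on a level interval of the distribution function. -/
lemma ae_cdf_lt_cdf [IsProbabilityMeasure (lineMeasure φ)] :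
    ∀ᵐ z ∂lineMeasure φ, ∀ y,
      (y < z → ProbabilityTheory.cdf (lineMeasure φ) y < ProbabilityTheory.cdf (lineMeasure φ) z) ∧
      (z < y → ProbabilityTheory.cdf (lineMeasure φ) z < ProbabilityTheory.cdf (lineMeasure φ) y) := by
  set F := ProbabilityTheory.cdf (lineMeasure φ) with hF
  -- Every nontrivial level interval contains a rational, so avoiding the countably many values `F
  -- q`, each of measure zero for the image measure, avoids all of them.
  have h : ∀ᵐ z ∂lineMeasure φ, ∀ q : ℚ, F z ≠ F q := by
    refine ae_all_iff.2 fun q => ?_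
    have h1 : ∀ᵐ t ∂unitMeasure, t ≠ F q := by
      rw [ae_unitMeasure_iff]
      filter_upwards [Measure.ae_ne volume (F q)] with t ht _ using ht
    have h2 := (measurePreserving_cdf (φ := φ)).quasiMeasurePreserving.ae h1
    filter_upwards [h2] with z hz using hz
  filter_upwards [h] with z hz y
  constructor
  · intro hy
    obtain ⟨q, hq1, hq2⟩ := exists_rat_btwn hy
    exact (F.mono hq1.le).trans_lt (lt_of_le_of_ne (F.mono hq2.le) (hz q).symm)
  · intro hy
    obtain ⟨q, hq1, hq2⟩ := exists_rat_btwn hy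
    exact (lt_of_le_of_ne (F.mono hq1.le) (hz q)).trans_le (F.mono hq2.le)

lemma ae_invCdf_cdf [IsProbabilityMeasure (lineMeasure φ)] :
    ∀ᵐ z ∂lineMeasure φ, invCdf φ (ProbabilityTheory.cdf (lineMeasure φ) z) = z := by
  filter_upwards [ae_cdf_lt_cdf] with z hz
  have : {x | ProbabilityTheory.cdf (lineMeasure φ) z ≤ ProbabilityTheory.cdf (lineMeasure φ) x} =
      Ici z := by
    ext x
    refine ⟨fun hx => ?_, fun hx => (ProbabilityTheory.cdf (lineMeasure φ)).mono hx⟩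
    by_contra! hlt
    exact absurd hx (not_le.2 ((hz x).1 (not_le.1 hlt)))
  rw [invCdf, this, csInf_Ici]

lemma ae_density_pos (hφm : Measurable φ) : ∀ᵐ z ∂lineMeasure φ, 0 < φ z := by
  rw [lineMeasure, ae_withDensity_iff hφm.ennreal_ofReal]
  exact ae_of_all _ fun z hz => by simpa using hz

lemma ae_density_le [IsProbabilityMeasure (lineMeasure φ)] {I : ℝ → ℝ≥0∞} {c : ℝ≥0}
    (hc : ∀ t ∈ Ioo (0 : ℝ) 1, c * ENNReal.ofReal (φ (invCdf φ t)) ≤ I t) :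
    ∀ᵐ z ∂lineMeasure φ,
      c * ENNReal.ofReal (φ z) ≤ I (ProbabilityTheory.cdf (lineMeasure φ) z) := by
  filter_upwards [ae_invCdf_cdf, ae_cdf_mem_Ioo] with z hz hz1
  have := hc _ hz1
  rwa [hz] at this

variable {n : ℕ}

lemma measurePreserving_coord [IsProbabilityMeasure (lineMeasure φ)] (i : Fin n) :
    MeasurePreserving (fun x : EuclideanSpace ℝ (Fin n) => x i) (prodMeasure n φ)
      (lineMeasure φ) := by
  have h1 : Measurable fun x : EuclideanSpace ℝ (Fin n) => x i := by fun_prop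
  refine ⟨h1, ?_⟩
  rw [prodMeasure, Measure.map_map h1 (WithLp.measurable_toLp _ _)]
  exact (measurePreserving_eval (fun _ : Fin n => lineMeasure φ) i).map_eq

lemma isProbabilityMeasure_prodMeasure [IsProbabilityMeasure (lineMeasure φ)] :
    IsProbabilityMeasure (prodMeasure n φ) :=
  Measure.isProbabilityMeasure_map (WithLp.measurable_toLp _ _).aemeasurable

lemma measurePreserving_cdf_coord [IsProbabilityMeasure (lineMeasure φ)] (i : Fin n) :
    MeasurePreserving (fun x : EuclideanSpace ℝ (Fin n) =>
      ProbabilityTheory.cdf (lineMeasure φ) (x i)) (prodMeasure n φ) unitMeasure :=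
  measurePreserving_cdf.comp (measurePreserving_coord i)

end LineMeasure

/-! ### Regularity of the isoperimetric profile -/

section Profile

lemma isoProfile_of_nonpos {Ω : Type*} [PseudoMetricSpace Ω] [MeasurableSpace Ω] (μ : Measure Ω)
    {t : ℝ} (ht : t ≤ 0) : isoProfile μ t = isoProfile μ 0 := by
  simp only [isoProfile, ENNReal.ofReal_of_nonpos ht, ENNReal.ofReal_zero]

lemma isoProfile_of_one_lt {Ω : Type*} [PseudoMetricSpace Ω] [MeasurableSpace Ω] (μ : Measure Ω)
    [IsProbabilityMeasure μ] {t : ℝ} (ht : 1 < t) : isoProfile μ t = ∞ := by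
  simp only [isoProfile, iInf_eq_top]
  intro A _ hA
  have h1 : μ A ≤ 1 := prob_le_one
  rw [hA, ENNReal.ofReal_le_one] at h1
  exact absurd h1 (not_le.2 ht)

/-- Continuity is known only on `[0,1]`; outside, the profile is constant on the left, where
`ENNReal.ofReal` truncates, and infinite on the right, as an infimum over no sets. -/
lemma measurable_isoProfile {Ω : Type*} [PseudoMetricSpace Ω] [MeasurableSpace Ω] (μ : Measure Ω)
    [IsProbabilityMeasure μ] (h : ContinuousOn (isoProfile μ) (Icc 0 1)) :
    Measurable (isoProfile μ) := by
  classical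
  have h1 : Measurable ((Icc (0 : ℝ) 1).piecewise (isoProfile μ) fun _ => 0) :=
    h.measurable_piecewise continuousOn_const measurableSet_Icc
  have h2 : isoProfile μ = (Iio (0 : ℝ)).piecewise (fun _ => isoProfile μ 0)
      ((Ioi (1 : ℝ)).piecewise (fun _ => ∞)
        ((Icc (0 : ℝ) 1).piecewise (isoProfile μ) fun _ => 0)) := by
    ext t
    rcases lt_or_ge t 0 with h0 | h0
    · rw [piecewise_eq_of_mem _ _ _ (mem_Iio.2 h0), isoProfile_of_nonpos μ h0.le]
    · rw [piecewise_eq_of_notMem _ _ _ (by simpa using h0)]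
      rcases lt_or_ge 1 t with h1 | h1
      · rw [piecewise_eq_of_mem _ _ _ (mem_Ioi.2 h1), isoProfile_of_one_lt μ h1]
      · rw [piecewise_eq_of_notMem _ _ _ (by simpa using h1),
          piecewise_eq_of_mem _ _ _ (mem_Icc.2 ⟨h0, h1⟩)]
  rw [h2]
  exact measurable_const.piecewise measurableSet_Iio
    (measurable_const.piecewise measurableSet_Ioi h1)

/-- A concave nonnegative symmetric profile that does not vanish identically satisfies the
estimates in `ProfileBounds`. -/
lemma RegularProfile.profileBounds {I : ℝ → ℝ≥0∞} (hI : RegularProfile I) (hm : Measurable I)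
    (hne : ∃ t ∈ Ioo (0 : ℝ) 1, I t ≠ 0) : ProfileBounds I := by
  have hfin : ∀ t ∈ Ioo (0 : ℝ) 1, I t ≠ ∞ := fun t ht => hI.ne_top t (Ioo_subset_Icc_self ht)
  have hconc := hI.concave.2
  have hnn : ∀ t, 0 ≤ (I t).toReal := fun t => ENNReal.toReal_nonneg
  refine ⟨hm, ?_, hfin, ?_, ?_⟩
  · intro t ht h0
    obtain ⟨s, hs, hsne⟩ := hne
    have hs0 : 0 < (I s).toReal := ENNReal.toReal_pos hsne (hfin s hs)
    have ht0 : (I t).toReal = 0 := by simp [h0]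
    rcases le_total s t with hst | hst
    · have h1s : 0 < 1 - s := by linarith [hs.2]
      have h := hconc (Ioo_subset_Icc_self hs) (right_mem_Icc.2 zero_le_one)
        (a := (1 - t) / (1 - s)) (b := (t - s) / (1 - s))
        (div_nonneg (by linarith [ht.2]) h1s.le) (div_nonneg (by linarith) h1s.le)
        (by field_simp; ring)
      have e : ((1 - t) / (1 - s)) • s + ((t - s) / (1 - s)) • (1 : ℝ) = t := by
        simp only [smul_eq_mul]
        field_simp
        ring
      rw [e] at h
      simp only [ht0, smul_eq_mul] at h
      have p1 : 0 < (1 - t) / (1 - s) * (I s).toReal :=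
        mul_pos (div_pos (by linarith [ht.2]) h1s) hs0
      have p2 : 0 ≤ (t - s) / (1 - s) * (I 1).toReal :=
        mul_nonneg (div_nonneg (by linarith) h1s.le) (hnn 1)
      linarith
    · have hsp := hs.1
      have h := hconc (Ioo_subset_Icc_self hs) (left_mem_Icc.2 zero_le_one)
        (a := t / s) (b := (s - t) / s)
        (div_nonneg ht.1.le hs.1.le) (div_nonneg (by linarith) hs.1.le)
        (by field_simp; ring)
      have e : (t / s) • s + ((s - t) / s) • (0 : ℝ) = t := by
        simp only [smul_eq_mul]
        field_simp
        ring
      rw [e] at h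
      simp only [ht0, smul_eq_mul] at h
      have p1 : 0 < t / s * (I s).toReal := mul_pos (div_pos ht.1 hs.1) hs0
      have p2 : 0 ≤ (s - t) / s * (I 0).toReal :=
        mul_nonneg (div_nonneg (by linarith) hs.1.le) (hnn 0)
      linarith
  · intro s t hs hst ht
    -- Monotonicity is assumed on the open interval only. At `1/2` it follows from concavity at the
    -- midpoint of `s` and `1 - s`, with symmetry.
    rcases eq_or_lt_of_le ht with rfl | ht
    · have hs1 : s ∈ Icc (0 : ℝ) 1 := ⟨hs.le, by linarith⟩
      have hs1' : 1 - s ∈ Icc (0 : ℝ) 1 := ⟨by linarith, by linarith⟩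
      have h := hconc hs1 hs1' (a := 1 / 2) (b := 1 / 2) (by norm_num) (by norm_num) (by norm_num)
      have e : (1 / 2 : ℝ) • s + (1 / 2 : ℝ) • (1 - s) = 1 / 2 := by
        simp only [smul_eq_mul]
        ring
      rw [e] at h
      simp only [hI.symmetric s hs1, smul_eq_mul] at h
      refine (ENNReal.toReal_le_toReal (hI.ne_top s hs1) (hfin _ (by norm_num))).1 ?_
      linarith
    · exact hI.monotone ⟨hs, hst.trans_lt ht⟩ ⟨hs.trans_le hst, ht⟩ hst
  · intro s t hs hst ht
    have ht0 : 0 < t := hs.trans_le hst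
    have hs1 : s ∈ Ioo (0 : ℝ) 1 := ⟨hs, hst.trans_lt ht⟩
    have ht1 : t ∈ Ioo (0 : ℝ) 1 := ⟨ht0, ht⟩
    have h := hconc (Ioo_subset_Icc_self ht1) (left_mem_Icc.2 zero_le_one)
      (a := s / t) (b := (t - s) / t)
      (div_nonneg hs.le ht0.le) (div_nonneg (by linarith) ht0.le) (by field_simp; ring)
    have e : (s / t) • t + ((t - s) / t) • (0 : ℝ) = s := by
      simp only [smul_eq_mul]
      field_simp
      ring
    rw [e] at h
    simp only [smul_eq_mul] at h
    have p2 : 0 ≤ (t - s) / t * (I 0).toReal :=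
      mul_nonneg (div_nonneg (by linarith) ht0.le) (hnn 0)
    have h2 : (I t).toReal * s ≤ (I s).toReal * t := by
      have h3 : s / t * (I t).toReal ≤ (I s).toReal := by linarith
      rw [div_mul_eq_mul_div, div_le_iff₀ ht0] at h3
      linarith
    rw [← ENNReal.ofReal_toReal (hfin t ht1), ← ENNReal.ofReal_toReal (hfin s hs1),
      ← ENNReal.ofReal_mul (hnn t), ← ENNReal.ofReal_mul (hnn s)]
    exact ENNReal.ofReal_le_ofReal h2

/-- The profile is nonzero somewhere because it dominates a multiple of the density, which is
positive almost everywhere for its own measure. -/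
lemma profileBounds_isoProfile {n : ℕ} {φ : ℝ → ℝ} (hφm : Measurable φ)
    [IsProbabilityMeasure (lineMeasure φ)] [IsProbabilityMeasure (prodMeasure n φ)]
    (hreg : RegularProfile (isoProfile (prodMeasure n φ))) {c : ℝ≥0} (hc0 : 0 < c)
    (hc : ∀ t ∈ Ioo (0 : ℝ) 1,
      c * ENNReal.ofReal (φ (invCdf φ t)) ≤ isoProfile (prodMeasure n φ) t) :
    ProfileBounds (isoProfile (prodMeasure n φ)) := by
  refine hreg.profileBounds (measurable_isoProfile _ hreg.continuous) ?_
  obtain ⟨z, h1, h2, h3⟩ :=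
    ((ae_density_pos hφm).and ((ae_density_le hc).and ae_cdf_mem_Ioo)).exists
  refine ⟨_, h3, fun h0 => ?_⟩
  rw [h0, nonpos_iff_eq_zero, mul_eq_zero, ENNReal.ofReal_eq_zero] at h2
  rcases h2 with h2 | h2
  · exact hc0.ne' (by exact_mod_cast h2)
  · linarith

end Profile

/-! ### From the Poincaré inequality to the Hardy inequality -/

section PoincareToHardy

lemma gradMod_comp_coord_le {n : ℕ} (i : Fin n) {u : ℝ → ℝ} {d : ℝ}
    {x : EuclideanSpace ℝ (Fin n)} (hu : HasDerivAt u d (x i)) :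
    gradMod (fun y : EuclideanSpace ℝ (Fin n) => u (y i)) x ≤ ENNReal.ofReal |d| := by
  refine ENNReal.le_of_forall_pos_le_add fun ε hε _ => ?_
  have h1 := (hasDerivAt_iff_isLittleO.1 hu).def (show (0 : ℝ) < ε from hε)
  have hc : Tendsto (fun y : EuclideanSpace ℝ (Fin n) => y i) (𝓝[≠] x) (𝓝 (x i)) := by
    have : Continuous fun y : EuclideanSpace ℝ (Fin n) => y i := by fun_prop
    exact (this.tendsto x).mono_left nhdsWithin_le_nhds
  refine limsup_le_of_le (by isBoundedDefault) ?_
  filter_upwards [hc.eventually h1] with y hy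
  rw [← ENNReal.ofReal_coe_nnreal, ← ENNReal.ofReal_add (abs_nonneg _) ε.coe_nonneg]
  refine ENNReal.ofReal_le_ofReal (div_le_of_le_mul₀ dist_nonneg (by positivity) ?_)
  have hd : |y i - x i| ≤ dist x y := by
    rw [dist_comm, ← Real.dist_eq]
    exact PiLp.dist_apply_le y x i
  simp only [smul_eq_mul, Real.norm_eq_abs] at hy
  have h2 : |u (x i) - u (y i)| ≤ |u (y i) - u (x i) - (y i - x i) * d| + |y i - x i| * |d| := by
    rw [← abs_mul, abs_sub_comm]
    have := abs_add_le (u (y i) - u (x i) - (y i - x i) * d) ((y i - x i) * d)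
    rwa [sub_add_cancel] at this
  calc |u (x i) - u (y i)| ≤ ε * |y i - x i| + |y i - x i| * |d| := h2.trans (by gcongr)
    _ = (|d| + ε) * |y i - x i| := by ring
    _ ≤ _ := by gcongr

/-- A primitive of a bounded density: Lipschitz, with the expected derivative almost everywhere. -/
lemma exists_primitive {w : ℝ → ℝ≥0∞} (hw : Measurable w) {M : ℝ≥0} (hwM : ∀ z, w z ≤ M) {m : ℝ}
    (hwm : ∀ z, m ≤ z → w z = 0) :
    ∃ u : ℝ → ℝ, LipschitzWith M u ∧ (∀ᵐ z, HasDerivAt u (w z).toReal z) ∧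
      ∀ y, ‖u y‖ₑ = ∫⁻ z in Ioi y, w z := by
  set v : ℝ → ℝ := fun z => (w z).toReal with hv
  have hvm : Measurable v := hw.ennreal_toReal
  have hvM : ∀ z, ‖v z‖ ≤ M := fun z => by
    rw [Real.norm_of_nonneg ENNReal.toReal_nonneg]
    exact ENNReal.toReal_le_coe_of_le_coe (hwM z)
  have hloc : LocallyIntegrable v volume :=
    (locallyIntegrable_const (M : ℝ)).mono hvm.aestronglyMeasurable
      (ae_of_all _ fun z => (hvM z).trans (by simp))
  have hint : ∀ a b, IntervalIntegrable v volume a b := fun a b =>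
    intervalIntegrable_iff.2 ((hloc.integrableOn_isCompact isCompact_uIcc).mono_set
      uIoc_subset_uIcc)
  refine ⟨fun y => ∫ z in m..y, v z, ?_, ?_, ?_⟩
  · refine LipschitzWith.of_dist_le_mul fun x y => ?_
    rw [dist_eq_norm, intervalIntegral.integral_interval_sub_left (hint _ _) (hint _ _),
      Real.dist_eq]
    exact intervalIntegral.norm_integral_le_of_norm_le_const fun z _ => hvM z
  · filter_upwards [LocallyIntegrable.ae_hasDerivAt_integral hloc] with z hz using hz m
  · intro y
    change ‖∫ z in m..y, v z‖ₑ = _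
    have hzero : ∫⁻ z in Ici m, w z = 0 := by
      rw [setLIntegral_congr_fun measurableSet_Ici (fun z hz => hwm z hz)]
      simp
    rcases le_total y m with h | h
    · have e1 : ∫⁻ z in Ioi y, w z = ∫⁻ z in Ioc y m, w z := by
        refine le_antisymm ?_ (lintegral_mono_set Ioc_subset_Ioi_self)
        rw [← Ioc_union_Ioi_eq_Ioi h]
        refine (lintegral_union_le _ _ _).trans ?_
        rw [nonpos_iff_eq_zero.1 ((lintegral_mono_set Ioi_subset_Ici_self).trans hzero.le), add_zero]
      have hfin : ∫⁻ z in Ioc y m, w z ≠ ∞ := by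
        refine ne_top_of_le_ne_top ?_ (lintegral_mono hwM)
        simp [ENNReal.mul_eq_top]
      rw [intervalIntegral.integral_symm, enorm_neg, intervalIntegral.integral_of_le h, e1, hv,
        integral_toReal hw.aemeasurable (ae_of_all _ fun z => (hwM z).trans_lt ENNReal.coe_lt_top),
        Real.enorm_of_nonneg ENNReal.toReal_nonneg, ENNReal.ofReal_toReal hfin]
    · have e1 : ∫⁻ z in Ioi y, w z = 0 :=
        nonpos_iff_eq_zero.1 ((lintegral_mono_set (fun z hz => h.trans (le_of_lt hz))).trans hzero.le)
      have e2 : ∫ z in m..y, v z = 0 := by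
        rw [intervalIntegral.integral_of_le h]
        refine setIntegral_eq_zero_of_forall_eq_zero fun z hz => ?_
        simp [hv, hwm z hz.1.le]
      rw [e1, e2, enorm_zero]

variable {n : ℕ} {φ : ℝ → ℝ}

/-- The Hardy transform of a bounded function is realised by a Lipschitz function of one
coordinate whose gradient is controlled by the function itself. -/
lemma exists_lipschitz_hardyOp (hφm : Measurable φ) [IsProbabilityMeasure (lineMeasure φ)]
    {I : ℝ → ℝ≥0∞} (hI : ProfileBounds I) {c : ℝ≥0} (hc0 : 0 < c)
    (hc : ∀ t ∈ Ioo (0 : ℝ) 1, c * ENNReal.ofReal (φ (invCdf φ t)) ≤ I t) (i : Fin n)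
    {f : ℝ → ℝ≥0∞} (hf : Measurable f) (hfs : Function.support f ⊆ Ioo 0 (1 / 2)) {M : ℝ≥0}
    (hfM : ∀ t, f t ≤ M) :
    ∃ (g : EuclideanSpace ℝ (Fin n) → ℝ) (K : ℝ≥0), LipschitzWith K g ∧
      (∀ x, ‖g x‖ₑ = hardyOp I f (ProbabilityTheory.cdf (lineMeasure φ) (x i))) ∧
      ∀ᵐ x ∂prodMeasure n φ, gradMod g x ≤
        (c⁻¹ : ℝ≥0) * f (ProbabilityTheory.cdf (lineMeasure φ) (x i)) := by
  set ν := lineMeasure φ with hν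
  set F := ProbabilityTheory.cdf ν with hF
  have hFc : Continuous F := continuous_cdf_lineMeasure
  have hFm : Measurable F := hFc.measurable
  set q : ℝ → ℝ≥0∞ := fun t => f t / I t with hq
  have hqm : Measurable q := hf.div hI.measurable
  set v : ℝ → ℝ≥0∞ := fun z => ENNReal.ofReal (φ z) * q (F z) with hv
  have hvm : Measurable v := hφm.ennreal_ofReal.mul (hqm.comp hFm)
  have hv_le : ∀ᵐ z ∂ν, v z ≤ (c⁻¹ : ℝ≥0) * f (F z) := by
    filter_upwards [ae_density_le hc, ae_cdf_mem_Ioo] with z hz hz1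
    have hpos := hI.pos _ hz1
    have hne := hI.ne_top _ hz1
    have h1 : ENNReal.ofReal (φ z) ≤ (c⁻¹ : ℝ≥0) * I (F z) := by
      rw [ENNReal.coe_inv hc0.ne', mul_comm, ← div_eq_mul_inv,
        ENNReal.le_div_iff_mul_le (Or.inl (by simpa using hc0.ne')) (Or.inl ENNReal.coe_ne_top),
        mul_comm]
      exact hz
    calc v z ≤ (c⁻¹ : ℝ≥0) * I (F z) * q (F z) := by
          simp only [hv]
          gcongr
      _ = (c⁻¹ : ℝ≥0) * f (F z) := by
          simp only [hq]
          rw [mul_assoc, ENNReal.mul_div_cancel hpos hne]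
  -- The bound on `v` holds only almost everywhere; capping it gives a version bounded everywhere,
  -- whose primitive is Lipschitz. The two agree for Lebesgue measure too, as `v` vanishes where `φ`
  -- does.
  set w : ℝ → ℝ≥0∞ := fun z => min (v z) (c⁻¹ * M : ℝ≥0) with hw
  have hwm : Measurable w := hvm.min measurable_const
  have hwv : ∀ᵐ z, w z = v z := by
    have := hv_le
    rw [hν, lineMeasure, ae_withDensity_iff hφm.ennreal_ofReal] at this
    filter_upwards [this] with z hz
    by_cases h0 : ENNReal.ofReal (φ z) = 0
    · simp [hw, hv, h0]
    · refine min_eq_left ((hz h0).trans ?_)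
      rw [ENNReal.coe_mul]
      gcongr
      exact hfM _
  obtain ⟨m, hm⟩ := mem_range_of_exists_le_of_exists_ge hFc
    ((ProbabilityTheory.tendsto_cdf_atBot ν).eventually
      (ge_mem_nhds (show (0 : ℝ) < 1 / 2 by norm_num))).exists
    ((ProbabilityTheory.tendsto_cdf_atTop ν).eventually
      (le_mem_nhds (show (1 / 2 : ℝ) < 1 by norm_num))).exists
  have hwz : ∀ z, m ≤ z → w z = 0 := by
    intro z hz
    have h1 : f (F z) = 0 := by
      by_contra h0
      exact absurd (hfs h0).2 (not_lt.2 (hm ▸ F.mono hz))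
    simp [hw, hv, hq, h1]
  obtain ⟨u, huL, hud, hun⟩ := exists_primitive hwm (fun z => min_le_right _ _) hwz
  have hcoord : LipschitzWith 1 fun x : EuclideanSpace ℝ (Fin n) => x i :=
    LipschitzWith.of_dist_le_mul fun x y => by
      rw [NNReal.coe_one, one_mul]
      exact PiLp.dist_apply_le x y i
  refine ⟨fun x => u (x i), _, huL.comp hcoord, fun x => ?_, ?_⟩
  · rw [hun]
    set y := x i
    calc ∫⁻ z in Ioi y, w z = ∫⁻ z in Ioi y, v z :=
          lintegral_congr_ae (ae_restrict_of_ae hwv)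
      _ = ∫⁻ z in Ioi y, q (F z) ∂ν :=
          (setLIntegral_withDensity_eq_setLIntegral_mul volume hφm.ennreal_ofReal
            (hqm.comp hFm) measurableSet_Ioi).symm
      -- For almost every `z`, `y < z` is equivalent to `F y < F z`, so the half-line can be
      -- described in terms of `F z` and the integral pushed forward.
      _ = ∫⁻ z, (Ioi (F y)).indicator q (F z) ∂ν := by
          rw [← lintegral_indicator measurableSet_Ioi]
          refine lintegral_congr_ae ?_
          filter_upwards [ae_cdf_lt_cdf] with z hz
          by_cases hyz : y < z
          · rw [indicator_of_mem (mem_Ioi.2 hyz), indicator_of_mem (mem_Ioi.2 ((hz y).1 hyz))]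
          · rw [indicator_of_notMem (by simpa using hyz),
              indicator_of_notMem (by simpa using F.mono (not_lt.1 hyz))]
      _ = ∫⁻ t, (Ioi (F y)).indicator q t ∂unitMeasure :=
          measurePreserving_cdf.lintegral_comp (hqm.indicator measurableSet_Ioi)
      _ = hardyOp I f (F y) := by
          have hset : Ioi (F y) ∩ Ioo 0 1 = Ioo (F y) 1 := by
            ext t
            simp only [mem_inter_iff, mem_Ioi, mem_Ioo]
            exact ⟨fun h => ⟨h.1, h.2.2⟩, fun h =>
              ⟨h.1, (ProbabilityTheory.cdf_nonneg ν y).trans_lt h.1, h.2⟩⟩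
          rw [lintegral_indicator measurableSet_Ioi, unitMeasure,
            Measure.restrict_restrict measurableSet_Ioi, hset]
          rfl
  · have h1 : ∀ᵐ z ∂ν, HasDerivAt u (w z).toReal z ∧ w z = v z :=
      (lineMeasure_absolutelyContinuous φ).ae_le (hud.and hwv)
    have h2 := (measurePreserving_coord (φ := φ) i).quasiMeasurePreserving.ae (h1.and hv_le)
    filter_upwards [h2] with x hx
    obtain ⟨⟨hx1, hx2⟩, hx3⟩ := hx
    refine (gradMod_comp_coord_le i hx1).trans ?_
    rw [abs_of_nonneg ENNReal.toReal_nonneg]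
    exact ENNReal.ofReal_toReal_le.trans (hx2.trans_le hx3)

/-- A function that vanishes on a set of measure at least one half is controlled by its deviation
from any constant. -/
lemma norm_le_of_vanishing {Ω : Type*} [MeasurableSpace Ω] {μ : Measure Ω} {Y : RINorm μ}
    {D : ℝ≥0} (hD : ∀ f, Measurable f → ∫⁻ x, f x ∂μ ≤ D * Y.norm f) {g : Ω → ℝ}
    (hg : Measurable g) {E : Set Ω} (hE : MeasurableSet E) (hμE : 1 / 2 ≤ μ E)
    (hgE : ∀ x ∈ E, g x = 0) (a : ℝ) :
    Y.norm (fun x => ‖g x‖ₑ) ≤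
      (1 + 2 * D * Y.norm fun _ => 1) * Y.norm fun x => ‖g x - a‖ₑ := by
  set A := Y.norm fun x => ‖g x - a‖ₑ with hA
  have hm : Measurable fun x => ‖g x - a‖ₑ := (hg.sub_const a).enorm
  have h1 : ‖a‖ₑ ≤ 2 * D * A := by
    have h2 : ‖a‖ₑ * (1 / 2) ≤ D * A := by
      calc ‖a‖ₑ * (1 / 2) ≤ ‖a‖ₑ * μ E := by gcongr
        _ = ∫⁻ x in E, ‖g x - a‖ₑ ∂μ := by
            rw [← setLIntegral_const]
            refine setLIntegral_congr_fun hE fun x hx => ?_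
            simp [hgE x hx]
        _ ≤ ∫⁻ x, ‖g x - a‖ₑ ∂μ := setLIntegral_le_lintegral _ _
        _ ≤ D * A := hD _ hm
    calc ‖a‖ₑ = 2 * (‖a‖ₑ * (1 / 2)) := by
          rw [mul_left_comm, one_div, ENNReal.mul_inv_cancel (by simp) (by simp), mul_one]
      _ ≤ 2 * (D * A) := by gcongr
      _ = _ := by ring
  calc Y.norm (fun x => ‖g x‖ₑ) ≤ Y.norm (fun x => ‖g x - a‖ₑ + (‖a‖₊ : ℝ≥0∞)) := by
        refine Y.norm_mono _ _ hg.enorm (hm.add_const _) (ae_of_all _ fun x => ?_)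
        rw [← enorm_eq_nnnorm]
        simpa using enorm_add_le (g x - a) a
    _ ≤ A + Y.norm (fun _ => (‖a‖₊ : ℝ≥0∞)) := Y.norm_add_le _ _ hm measurable_const
    _ = A + ‖a‖ₑ * Y.norm (fun _ => 1) := by rw [Y.norm_const, enorm_eq_nnnorm]
    _ ≤ A + 2 * D * A * Y.norm (fun _ => 1) := by gcongr
    _ = _ := by ring

/-- For bounded `f` the Poincaré inequality is tested on the one-coordinate Lipschitz function
realising the Hardy transform, which is zero where `F (x i) ≥ 1/2`. General `f` is reached through
`min f k` and the Fatou property of the norm. -/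
theorem hardyBounded_of_poincare (hφm : Measurable φ) [IsProbabilityMeasure (lineMeasure φ)]
    [IsProbabilityMeasure (prodMeasure n φ)]
    {I : ℝ → ℝ≥0∞} (hI : ProfileBounds I) {c : ℝ≥0} (hc0 : 0 < c)
    (hc : ∀ t ∈ Ioo (0 : ℝ) 1, c * ENNReal.ofReal (φ (invCdf φ t)) ≤ I t) (i : Fin n)
    {X Y : RINorm (prodMeasure n φ)} (hP : Poincare X Y) : HardyBounded I X Y := by
  obtain ⟨C, hC⟩ := hP
  obtain ⟨D, hD⟩ := Y.exists_lintegral_le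
  have hY1 : Y.norm (fun _ => 1) ≠ ∞ := Y.norm_one_lt_top.ne
  have hU := measurePreserving_cdf_coord (n := n) (φ := φ) i
  set F := ProbabilityTheory.cdf (lineMeasure φ) with hF
  set B : ℝ≥0 := (1 + 2 * D * (Y.norm fun _ => 1).toNNReal) * (C * c⁻¹) with hB
  have hbdd : ∀ (f : ℝ → ℝ≥0∞) (M : ℝ≥0), Measurable f → Function.support f ⊆ Ioo 0 (1 / 2) →
      (∀ t, f t ≤ M) → Y.bar (hardyOp I f) ≤ B * X.bar f := by
    intro f M hf hfs hfM
    obtain ⟨g, K, hgL, hgn, hgg⟩ := exists_lipschitz_hardyOp hφm hI hc0 hc i hf hfs hfM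
    have hgm : Measurable g := hgL.continuous.measurable
    have hE : MeasurableSet {x : EuclideanSpace ℝ (Fin n) | 1 / 2 ≤ F (x i)} :=
      measurableSet_le measurable_const hU.measurable
    have hμE : 1 / 2 ≤ prodMeasure n φ {x | 1 / 2 ≤ F (x i)} := by
      have e1 : prodMeasure n φ {x | 1 / 2 ≤ F (x i)} = unitMeasure (Ici (1 / 2)) :=
        hU.measure_preimage measurableSet_Ici.nullMeasurableSet
      have hsub : Ioo (1 / 2 : ℝ) 1 ⊆ Ici (1 / 2) ∩ Ioo 0 1 := fun t ht =>
        ⟨ht.1.le, by linarith [ht.1], ht.2⟩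
      rw [e1, unitMeasure_apply]
      refine le_trans ?_ (measure_mono hsub)
      rw [Real.volume_Ioo, show (1 - 1 / 2 : ℝ) = 1 / 2 by norm_num,
        ENNReal.ofReal_div_of_pos (by norm_num)]
      simp
    have hgE : ∀ x ∈ {x : EuclideanSpace ℝ (Fin n) | 1 / 2 ≤ F (x i)}, g x = 0 := by
      intro x hx
      rw [← enorm_eq_zero, hgn x, hardyOp,
        setLIntegral_congr_fun (g := fun _ => 0) measurableSet_Ioo fun s hs => ?_]
      · simp
      · have : f s = 0 := by
          by_contra h0
          exact absurd (hfs h0).2 (not_lt.2 (le_trans hx hs.1.le))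
        simp [this]
    calc Y.bar (hardyOp I f) = Y.norm (fun x => ‖g x‖ₑ) := by
          rw [Y.bar_eq hU (measurable_hardyOp I f)]
          congr 1
          funext x
          exact (hgn x).symm
      _ ≤ (1 + 2 * D * Y.norm fun _ => 1) *
            Y.norm (fun x => ‖g x - ∫ y, g y ∂prodMeasure n φ‖ₑ) :=
          norm_le_of_vanishing hD hgm hE hμE hgE _
      _ ≤ (1 + 2 * D * Y.norm fun _ => 1) * (C * ((c⁻¹ : ℝ≥0) * X.bar f)) := by
          gcongr
          refine (hC g ⟨K, hgL⟩).trans ?_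
          gcongr
          rw [X.bar_eq hU hf, ← X.norm_smul _ _ (hf.comp hU.measurable)]
          exact X.norm_mono _ _ (measurable_gradMod hgL.continuous)
            ((hf.comp hU.measurable).const_mul _) hgg
      _ = B * X.bar f := by
          rw [hB]
          push_cast
          rw [ENNReal.coe_toNNReal hY1]
          ring
  refine ⟨B, fun f hf _ hfs => ?_⟩
  set fk : ℕ → ℝ → ℝ≥0∞ := fun k t => min (f t) k with hfk
  have hfkm : ∀ k, Measurable (fk k) := fun k => hf.min measurable_const
  have hmono : Monotone fk := fun j k hjk t =>
    min_le_min le_rfl (by exact_mod_cast hjk)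
  have hsup : ∀ t, ⨆ k, fk k t = f t := by
    intro t
    refine le_antisymm (iSup_le fun k => min_le_left _ _) ?_
    refine le_of_forall_lt fun a ha => ?_
    obtain ⟨k, hk⟩ := ENNReal.exists_nat_gt (ne_top_of_lt ha)
    exact (lt_min ha hk).trans_le (le_iSup (fun k => fk k t) k)
  have hHsup : hardyOp I f = fun t => ⨆ k, hardyOp I (fk k) t := by
    funext t
    simp only [hardyOp]
    have hqk : ∀ k, Measurable fun s => fk k s / I s := fun k => (hfkm k).div hI.measurable
    rw [← lintegral_iSup hqk fun j k hjk s => ENNReal.div_le_div_right (hmono hjk s) _]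
    refine lintegral_congr fun s => ?_
    rw [← hsup s, ENNReal.iSup_div]
  have hHmono : Monotone fun k => hardyOp I (fk k) := fun j k hjk t =>
    lintegral_mono fun s => ENNReal.div_le_div_right (hmono hjk s) _
  rw [hHsup, Y.bar_iSup hU (fun k => measurable_hardyOp _ _) hHmono]
  refine iSup_le fun k => ?_
  refine (hbdd (fk k) k (hfkm k) ?_ fun t => ?_).trans ?_
  · intro t ht
    refine hfs fun h0 => ht ?_
    simp [hfk, h0]
  · simp [hfk]
  · gcongr
    exact X.bar_mono hU (hfkm k) hf fun t _ => min_le_left _ _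

end PoincareToHardy

end IsoSym

theorem theorem2 (n : ℕ) (hn : 1 ≤ n) (φ : ℝ → ℝ) (hφm : Measurable φ) (hφ0 : ∀ x, 0 ≤ φ x)
    (hφ1 : ∫⁻ x, ENNReal.ofReal (φ x) = 1)
    (hreg : IsoSym.RegularProfile (IsoSym.isoProfile (IsoSym.prodMeasure n φ)))
    (hI : IsoSym.Comparable (IsoSym.isoProfile (IsoSym.prodMeasure n φ))
      (fun t => ENNReal.ofReal (φ (IsoSym.invCdf φ t))))
    (X Y : IsoSym.RINorm (IsoSym.prodMeasure n φ)) :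
    (IsoSym.Poincare X Y ↔
      IsoSym.HardyBounded (IsoSym.isoProfile (IsoSym.prodMeasure n φ)) X Y) ∧
    (IsoSym.QBounded (IsoSym.isoProfile (IsoSym.prodMeasure n φ)) X →
      (IsoSym.Poincare X Y ↔
        IsoSym.WeightedEmbedding (IsoSym.isoProfile (IsoSym.prodMeasure n φ)) X Y)) ∧
    (IsoSym.MaximalNormEquiv X →
      (IsoSym.Poincare X Y ↔
        IsoSym.LSEmbedding (IsoSym.isoProfile (IsoSym.prodMeasure n φ)) X Y)) := by
  have := IsoSym.isProbabilityMeasure_lineMeasure hφ1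
  have := IsoSym.isProbabilityMeasure_prodMeasure (n := n) (φ := φ)
  obtain ⟨c, C, hc0, hcC⟩ := hI
  have hc : ∀ t ∈ Ioo (0 : ℝ) 1, c * ENNReal.ofReal (φ (IsoSym.invCdf φ t)) ≤
      IsoSym.isoProfile (IsoSym.prodMeasure n φ) t := fun t ht => (hcC t ht).1
  have hB := IsoSym.profileBounds_isoProfile hφm hreg hc0 hc
  -- Positive dimension supplies a coordinate, and with it the map onto the unit interval.
  have hU := IsoSym.measurePreserving_cdf_coord (n := n) (φ := φ) ⟨0, hn⟩
  have hper : ∀ A : Set (EuclideanSpace ℝ (Fin n)), MeasurableSet A → ∀ t : ℝ,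
      IsoSym.prodMeasure n φ A = ENNReal.ofReal t →
      IsoSym.isoProfile (IsoSym.prodMeasure n φ) t ≤
        IsoSym.perimeter (IsoSym.prodMeasure n φ) A :=
    fun A hA t ht => iInf_le_of_le A (iInf_le_of_le hA (iInf_le _ ht))
  have hiff : IsoSym.Poincare X Y ↔
      IsoSym.HardyBounded (IsoSym.isoProfile (IsoSym.prodMeasure n φ)) X Y :=
    ⟨IsoSym.hardyBounded_of_poincare hφm hB hc0 hc ⟨0, hn⟩,
      IsoSym.poincare_of_hardyBounded hB hper hU⟩
  refine ⟨hiff, fun hQ => hiff.trans ⟨?_, ?_⟩, fun hM => hiff.trans ⟨?_, ?_⟩⟩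
  · exact IsoSym.weightedEmbedding_of_hardyBounded hB hU
  · exact IsoSym.hardyBounded_of_weightedEmbedding hB hU hQ
  · exact IsoSym.lsEmbedding_of_hardyBounded hB hU
  · exact IsoSym.hardyBounded_of_lsEmbedding hB hU hM
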